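/- Let $(M,g)$ be a complete smooth Riemannian manifold, let $SM$ be its unit tangent bundle, and for $v\in SM$ let $\gamma_v$ be the geodesic with $\gamma_v'(0)=v$. Let $R(X,Y)Z=\nabla_X\nabla_YZ-\nabla_Y\nabla_XZ-\nabla_{[X,Y]}Z$ be the curvature tensor; Jacobi fields along $\gamma$ are the solutions of $Y''+R(Y,\gamma')\gamma'=0$. The manifold has no conjugate points if a Jacobi field along a unit speed geodesic that vanishes at two distinct times is identically zero, and it has no focal points if $\frac{d}{dt}\|Y(t)\|^2>0$ for all $t>0$ whenever $Y$ is a Jacobi field along a unit speed geodesic with $Y(0)=0$ and $Y'(0)\neq 0$. When $M$ has no conjugate points, for $v\in SM$ and $T>0$ let $U_T^s(v):v^\perp\to v^\perp$ be the linear map $w\mapsto Y'(0)$, where $Y$ is the Jacobi field along $\gamma_v$ with $Y(0)=w$ and $Y(T)=0$ (so $U^s_T(v)=E_T'(0)$ for the Jacobi tensor $E_T$ along $\gamma_v$ with $E_T(0)=\mathrm{Id}$, $E_T(T)=0$), and let $U^s(v)=\lim_{T\to\infty}U_T^s(v)$ be the stable Riccati solution. The manifold $M$ is called asymptotically harmonic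 if it is complete, has no conjugate points, and $\operatorname{tr}U^s(v)$ is constant on $SM$. Lemma. Let $(M,g)$ be an asymptotically harmonic manifold without focal points such that $\operatorname{tr}U^s(v)=0$ for all $v\in SM$. Then $(M,g)$ is flat, that is, $R\equiv 0$. -/

import Mathlib

open Bundle Set Filter VectorField
open scoped Manifold ContDiff Topology

noncomputable section

namespace Riem

/-- A smooth Riemannian metric on a smooth manifold `M` (without boundary) modelled on `E`. -/
abbrev RiemMetric (E : Type*) [NormedAddCommGroup E] [NormedSpace ℝ E]
    (M : Type*) [TopologicalSpace M] [ChartedSpace E M] [IsManifold 𝓘(ℝ, E) ∞ M] :=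
  ContMDiffRiemannianMetric 𝓘(ℝ, E) ∞ E (fun x : M ↦ TangentSpace 𝓘(ℝ, E) x)

/-! ### Derivatives in the preferred chart at a point -/

section Chart

variable {E : Type*} [NormedAddCommGroup E]
  {M : Type*} [TopologicalSpace M] [ChartedSpace E M]

lemma chart_symm_self (x : M) : (chartAt E x).symm (chartAt E x x) = x :=
  (chartAt E x).left_inv (mem_chart_source E x)

variable [NormedSpace ℝ E] {F : Type*} [NormedAddCommGroup F] [NormedSpace ℝ F]

/-- The derivative of `f : M → F` at `x`, read in the preferred chart at `x`. -/
def chartDeriv (x : M) (f : M → F) : E →L[ℝ] F :=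
  fderiv ℝ (fun z ↦ f ((chartAt E x).symm z)) (chartAt E x x)

lemma differentiableAt_chart {x : M} {f : M → F} (h : MDifferentiableAt 𝓘(ℝ, E) 𝓘(ℝ, F) f x) :
    DifferentiableAt ℝ (fun z ↦ f ((chartAt E x).symm z)) (chartAt E x x) := by
  have := h.differentiableWithinAt_writtenInExtChartAt
  simp only [modelWithCornersSelf_coe, range_id, differentiableWithinAt_univ] at this
  exact this

lemma chartDeriv_add {x : M} {f h : M → F} (hf : MDifferentiableAt 𝓘(ℝ, E) 𝓘(ℝ, F) f x)
    (hh : MDifferentiableAt 𝓘(ℝ, E) 𝓘(ℝ, F) h x) :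
    chartDeriv (E := E) x (fun y ↦ f y + h y) = chartDeriv x f + chartDeriv x h :=
  fderiv_fun_add (differentiableAt_chart hf) (differentiableAt_chart hh)

lemma chartDeriv_smul {x : M} {f : M → ℝ} {h : M → F}
    (hf : MDifferentiableAt 𝓘(ℝ, E) 𝓘(ℝ, ℝ) f x)
    (hh : MDifferentiableAt 𝓘(ℝ, E) 𝓘(ℝ, F) h x) :
    chartDeriv (E := E) x (fun y ↦ f y • h y) =
      f x • chartDeriv x h + (chartDeriv x f).smulRight (h x) := by
  have := fderiv_fun_smul (differentiableAt_chart hf) (differentiableAt_chart hh)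
  rwa [chart_symm_self (E := E)] at this

set_option synthInstance.maxHeartbeats 200000 in
lemma chartDeriv_bilin {x : M} {B : M → E →L[ℝ] E →L[ℝ] ℝ} {a b : M → E}
    (hB : MDifferentiableAt 𝓘(ℝ, E) 𝓘(ℝ, E →L[ℝ] E →L[ℝ] ℝ) B x)
    (ha : MDifferentiableAt 𝓘(ℝ, E) 𝓘(ℝ, E) a x)
    (hb : MDifferentiableAt 𝓘(ℝ, E) 𝓘(ℝ, E) b x) (u : E) :
    chartDeriv (E := E) x (fun y ↦ B y (a y) (b y)) u =
      chartDeriv x B u (a x) (b x) + B x (chartDeriv x a u) (b x) +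
        B x (a x) (chartDeriv x b u) := by
  have := (((differentiableAt_chart hB).hasFDerivAt.clm_apply
    (differentiableAt_chart ha).hasFDerivAt).clm_apply
    (differentiableAt_chart hb).hasFDerivAt).fderiv
  rw [chart_symm_self (E := E)] at this
  refine (congrArg (fun l ↦ l u) this).trans ?_
  simp [chartDeriv]
  ring

end Chart

/-! ### The Levi-Civita connection -/

section Connection

variable {E : Type*} [NormedAddCommGroup E] [NormedSpace ℝ E]
  {M : Type*} [TopologicalSpace M] [ChartedSpace E M] [IsManifold 𝓘(ℝ, E) ∞ M]

/-- The components, in the preferred chart at `x`, of a tangent vector at `y`. -/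
def coord (x y : M) : TangentSpace 𝓘(ℝ, E) y →L[ℝ] E :=
  (trivializationAt E (TangentSpace 𝓘(ℝ, E)) x).continuousLinearMapAt ℝ y

/-- The tangent vector at `y` with given components in the preferred chart at `x`. -/
def coordSymm (x y : M) : E →L[ℝ] TangentSpace 𝓘(ℝ, E) y :=
  (trivializationAt E (TangentSpace 𝓘(ℝ, E)) x).symmL ℝ y

/-- The components `g_{ij}(y)` of the metric in the preferred chart at `x`. -/
def metricCoord (g : RiemMetric E M) (x y : M) : E →L[ℝ] E →L[ℝ] ℝ :=
  ((ContinuousLinearMap.precomp ℝ (coordSymm x y)) ∘L (g.inner y)) ∘L (coordSymm x y)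

set_option synthInstance.maxHeartbeats 200000 in
/-- The partial derivatives `∂ₖ g_{ij}` at `x` in the preferred chart at `x`; the first argument is
the direction of differentiation. -/
def dMetricCoord (g : RiemMetric E M) (x : M) : E →L[ℝ] E →L[ℝ] E →L[ℝ] ℝ :=
  chartDeriv x (metricCoord g x)

/-- The Christoffel symbols of the first kind:
`(u, z) ↦ (∂_u g(w, z) + ∂_w g(u, z) - ∂_z g(w, u)) / 2`. -/
def christoffelLower (g : RiemMetric E M) (x : M) (w : E) : E →L[ℝ] E →L[ℝ] ℝ :=
  (1 / 2 : ℝ) • ((dMetricCoord g x).flip w + dMetricCoord g x w -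
    ((dMetricCoord g x).flip w).flip)

/-- The Christoffel symbols at `x` in the preferred chart at `x`, as the map `u ↦ Γ(u, w)`. -/
def christoffel (g : RiemMetric E M) (x : M) (w : E) : E →L[ℝ] E :=
  (metricCoord g x x).inverse ∘L christoffelLower g x w

lemma christoffelLower_apply (g : RiemMetric E M) (x : M) (u w z : E) :
    christoffelLower g x w u z = 1 / 2 *
      (dMetricCoord g x u w z + dMetricCoord g x w u z - dMetricCoord g x z w u) := by
  simp [christoffelLower]

lemma coord_coordSymm {x y : M} (hy : y ∈ (chartAt E x).source) (v : E) :
    coord x y (coordSymm x y v) = v := by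
  unfold coord coordSymm
  exact (trivializationAt E (TangentSpace 𝓘(ℝ, E)) x).continuousLinearMapAt_symmL (by simpa using hy) v

lemma coordSymm_coord {x y : M} (hy : y ∈ (chartAt E x).source) (v : TangentSpace 𝓘(ℝ, E) y) :
    coordSymm x y (coord x y v) = v := by
  unfold coord coordSymm
  exact (trivializationAt E (TangentSpace 𝓘(ℝ, E)) x).symmL_continuousLinearMapAt (by simpa using hy) v

lemma coord_coordSymm_self (x : M) (v : E) : coord x x (coordSymm x x v) = v :=
  coord_coordSymm (mem_chart_source E x) v

lemma coordSymm_coord_self (x : M) (v : TangentSpace 𝓘(ℝ, E) x) :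
    coordSymm x x (coord x x v) = v :=
  coordSymm_coord (mem_chart_source E x) v

lemma coord_self (x : M) (v : TangentSpace 𝓘(ℝ, E) x) : coord x x v = v := by
  unfold coord
  rw [TangentBundle.continuousLinearMapAt_trivializationAt (mem_chart_source E x),
    mfderiv_extChartAt_self]
  rfl

lemma mvfderiv_eq_chartDeriv {x : M} {f : M → ℝ} (h : MDifferentiableAt 𝓘(ℝ, E) 𝓘(ℝ, ℝ) f x)
    (u : TangentSpace 𝓘(ℝ, E) x) :
    mvfderiv 𝓘(ℝ, E) f x u = chartDeriv x f (coord x x u) := by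
  rw [coord_self]
  simp only [mvfderiv, mfderiv, h, modelWithCornersSelf_coe, range_id, fderivWithin_univ]
  rfl

lemma mdiff_metricCoord (g : RiemMetric E M) (x : M) :
    MDifferentiableAt 𝓘(ℝ, E) 𝓘(ℝ, E →L[ℝ] E →L[ℝ] ℝ) (metricCoord g x) x := by
  have h := (g.contMDiff x).mdifferentiableAt (by simp)
  rw [mdifferentiableAt_section] at h
  refine h.congr_of_eventuallyEq ?_
  filter_upwards [(chartAt E x).open_source.mem_nhds (mem_chart_source E x)] with y hy
  ext u w
  simp [metricCoord, hom_trivializationAt_apply, ContinuousLinearMap.inCoordinates, coordSymm, Trivialization.linearMapAt_apply, hy]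

lemma mdiff_coord {σ : ∀ x : M, TangentSpace 𝓘(ℝ, E) x} {x : M}
    (h : MDiffAt (T% σ) x) : MDifferentiableAt 𝓘(ℝ, E) 𝓘(ℝ, E) (fun y ↦ coord x y (σ y)) x := by
  rw [mdifferentiableAt_section] at h
  refine h.congr_of_eventuallyEq ?_
  filter_upwards [(chartAt E x).open_source.mem_nhds (mem_chart_source E x)] with y hy
  simp [coord, Trivialization.continuousLinearMapAt_apply, Trivialization.linearMapAt_apply, hy]

set_option synthInstance.maxHeartbeats 200000 in
lemma christoffelLower_add (g : RiemMetric E M) (x : M) (w w' : E) :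
    christoffelLower g x (w + w') = christoffelLower g x w + christoffelLower g x w' := by
  ext u z
  simp only [christoffelLower_apply, add_apply, map_add]
  ring

set_option synthInstance.maxHeartbeats 200000 in
lemma christoffelLower_smul (g : RiemMetric E M) (x : M) (c : ℝ) (w : E) :
    christoffelLower g x (c • w) = c • christoffelLower g x w := by
  ext u z
  simp only [christoffelLower_apply, smul_apply, map_smul, smul_eq_mul]
  ring

lemma christoffel_add (g : RiemMetric E M) (x : M) (w w' : E) :
    christoffel g x (w + w') = christoffel g x w + christoffel g x w' := by
  simp [christoffel, christoffelLower_add]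

lemma christoffel_smul (g : RiemMetric E M) (x : M) (c : ℝ) (w : E) :
    christoffel g x (c • w) = c • christoffel g x w := by
  simp [christoffel, christoffelLower_smul]

/-- The Levi-Civita connection: `∇_u σ = ∂_u σ + Γ(u, σ)` at `x` in the preferred chart at `x`.
It is shown below to be compatible with the metric and torsion free. -/
def leviCivita (g : RiemMetric E M) :
    CovariantDerivative 𝓘(ℝ, E) E (TangentSpace 𝓘(ℝ, E) : M → Type _) where
  toFun σ x := coordSymm x x ∘L (chartDeriv x (fun y ↦ coord x y (σ y)) +
    christoffel g x (coord x x (σ x))) ∘L coord x x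
  isCovariantDerivativeOnUniv :=
    { add := by
        intro σ σ' x hσ hσ' _
        ext u
        have h : chartDeriv (E := E) x (fun y ↦ coord x y ((σ + σ') y)) =
            chartDeriv x (fun y ↦ coord x y (σ y)) + chartDeriv x (fun y ↦ coord x y (σ' y)) := by
          rw [← chartDeriv_add (mdiff_coord hσ) (mdiff_coord hσ')]
          simp
        rw [h]
        simp [christoffel_add]
        abel
      leibniz := by
        intro σ f x hσ hf _
        ext u
        have h : chartDeriv (E := E) x (fun y ↦ coord x y ((f • σ) y)) =
            f x • chartDeriv x (fun y ↦ coord x y (σ y)) +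
              (chartDeriv x f).smulRight (coord x x (σ x)) := by
          rw [← chartDeriv_smul hf (mdiff_coord hσ)]
          simp
        rw [h]
        simp [christoffel_smul, coordSymm_coord_self, mvfderiv_eq_chartDeriv hf]
        abel }

lemma leviCivita_apply (g : RiemMetric E M) (σ : ∀ x : M, TangentSpace 𝓘(ℝ, E) x) (x : M)
    (u : TangentSpace 𝓘(ℝ, E) x) :
    leviCivita g σ x u = coordSymm x x (chartDeriv x (fun y ↦ coord x y (σ y)) (coord x x u) +
      christoffel g x (coord x x (σ x)) (coord x x u)) := rfl

lemma metricCoord_apply (g : RiemMetric E M) (x y : M) (a b : E) :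
    metricCoord g x y a b = g.inner y (coordSymm x y a) (coordSymm x y b) := rfl

set_option synthInstance.maxHeartbeats 200000 in
lemma dMetricCoord_apply (g : RiemMetric E M) (x : M) (u w z : E) :
    dMetricCoord g x u w z = chartDeriv x (fun y ↦ metricCoord g x y w z) u := by
  have h := chartDeriv_bilin (mdiff_metricCoord g x) (mdifferentiableAt_const (c := w))
    (mdifferentiableAt_const (c := z)) u
  simpa [chartDeriv, dMetricCoord] using h.symm

lemma dMetricCoord_symm (g : RiemMetric E M) (x : M) (u w z : E) :
    dMetricCoord g x u w z = dMetricCoord g x u z w := by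
  rw [dMetricCoord_apply, dMetricCoord_apply]
  congr! 3 with y
  exact g.symm _ _ _

lemma mpullback_chart (x : M) (V : ∀ y : M, TangentSpace 𝓘(ℝ, E) y) :
    (mpullbackWithin 𝓘(ℝ, E) 𝓘(ℝ, E) (extChartAt 𝓘(ℝ, E) x).symm V (range 𝓘(ℝ, E)))
      =ᶠ[𝓝 (chartAt E x x)] fun z ↦ coord x ((chartAt E x).symm z) (V ((chartAt E x).symm z)) := by
  filter_upwards [(chartAt E x).open_target.mem_nhds (mem_chart_target E x)] with z hz
  have hy := (chartAt E x).map_target hz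
  have h1 := TangentBundle.symmL_trivializationAt (I := 𝓘(ℝ, E)) hy
  have h2 : extChartAt 𝓘(ℝ, E) x ((chartAt E x).symm z) = z := by
    simp [(chartAt E x).right_inv hz]
  rw [h2] at h1
  have hinv := isInvertible_mfderivWithin_extChartAt_symm (I := 𝓘(ℝ, E)) (x := x) (y := z)
    (by simpa using hz)
  rw [mpullbackWithin_apply]
  refine hinv.inverse_apply_eq.2 ?_
  have h3 := congrArg (fun l ↦ l (coord x ((chartAt E x).symm z) (V ((chartAt E x).symm z)))) h1
  exact (coordSymm_coord hy _).symm.trans h3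

lemma mlieBracket_coord (X Y : ∀ y : M, TangentSpace 𝓘(ℝ, E) y) (x : M) :
    mlieBracket 𝓘(ℝ, E) X Y x = coordSymm x x
      (chartDeriv x (fun y ↦ coord x y (Y y)) (coord x x (X x)) -
        chartDeriv x (fun y ↦ coord x y (X y)) (coord x x (Y x))) := by
  have hX := mpullback_chart x X
  have hY := mpullback_chart x Y
  rw [← mlieBracketWithin_univ, mlieBracketWithin_apply]
  have hb := hX.lieBracketWithin_vectorField_eq_nhds (𝕜 := ℝ)
    (s := (extChartAt 𝓘(ℝ, E) x).symm ⁻¹' univ ∩ range 𝓘(ℝ, E)) hY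
  have hi := isInvertible_mfderiv_extChartAt (I := 𝓘(ℝ, E))
    (mem_extChartAt_source (I := 𝓘(ℝ, E)) x)
  refine hi.inverse_apply_eq.2 ?_
  rw [mfderiv_extChartAt_self]
  refine Eq.trans hb ?_
  simp only [preimage_univ, univ_inter, modelWithCornersSelf_coe, range_id, lieBracketWithin_univ]
  rw [coord_self, coord_self]
  have : ∀ v : E, coordSymm x x v = v := fun v ↦ by
    rw [← coord_self x (coordSymm x x v), coord_coordSymm_self]
  simp only [lieBracket_eq, this]
  rw [chart_symm_self (E := E), coord_self, coord_self]
  rfl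

variable [FiniteDimensional ℝ E]

lemma metricCoord_bijective (g : RiemMetric E M) (x : M) : Function.Bijective (metricCoord g x x) := by
  have hinj : Function.Injective (metricCoord g x x) := by
    rw [injective_iff_map_eq_zero]
    intro a ha
    by_contra hne
    have h1 : coordSymm x x a ≠ 0 := by
      intro h0
      apply hne
      rw [← coord_coordSymm_self x a, h0, map_zero]
    have h2 := g.pos x _ h1
    have h3 := congrArg (fun l ↦ l a) ha
    simp only [metricCoord_apply] at h3
    simp [h3] at h2
  have hfr : Module.finrank ℝ E = Module.finrank ℝ (E →L[ℝ] ℝ) := by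
    rw [← (LinearMap.toContinuousLinearMap (𝕜 := ℝ) (E := E) (F' := ℝ)).finrank_eq]
    exact Subspace.dual_finrank_eq.symm
  exact ⟨hinj, (LinearMap.injective_iff_surjective_of_finrank_eq_finrank hfr
    (f := (metricCoord g x x).toLinearMap)).1 hinj⟩

lemma metricCoord_christoffel (g : RiemMetric E M) (x : M) (w u z : E) :
    metricCoord g x x (christoffel g x w u) z = christoffelLower g x w u z := by
  have hb := metricCoord_bijective g x
  let e : E ≃L[ℝ] (E →L[ℝ] ℝ) :=
    (LinearEquiv.ofBijective (metricCoord g x x).toLinearMap hb).toContinuousLinearEquiv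
  have he : (e : E →L[ℝ] (E →L[ℝ] ℝ)) = metricCoord g x x := by ext; rfl
  have : metricCoord g x x (christoffel g x w u) = christoffelLower g x w u := by
    simp only [christoffel, ContinuousLinearMap.comp_apply]
    rw [← he, ContinuousLinearMap.inverse_equiv]
    simp
  rw [this]

lemma christoffel_symm (g : RiemMetric E M) (x : M) (u w : E) :
    christoffel g x w u = christoffel g x u w := by
  apply (metricCoord_bijective g x).1
  ext z
  rw [metricCoord_christoffel, metricCoord_christoffel, christoffelLower_apply,
    christoffelLower_apply, dMetricCoord_symm g x z w u]
  ring

set_option synthInstance.maxHeartbeats 200000 in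
/-- The Levi-Civita connection is compatible with the metric. -/
theorem leviCivita_metric (g : RiemMetric E M) {x : M} {σ τ : ∀ x : M, TangentSpace 𝓘(ℝ, E) x}
    (hσ : MDiffAt (T% σ) x) (hτ : MDiffAt (T% τ) x) (u : TangentSpace 𝓘(ℝ, E) x) :
    mvfderiv 𝓘(ℝ, E) (fun y ↦ g.inner y (σ y) (τ y)) x u =
      g.inner x (leviCivita g σ x u) (τ x) + g.inner x (σ x) (leviCivita g τ x u) := by
  have hE : (fun y ↦ g.inner y (σ y) (τ y)) =ᶠ[𝓝 x]
      fun y ↦ metricCoord g x y (coord x y (σ y)) (coord x y (τ y)) := by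
    filter_upwards [(chartAt E x).open_source.mem_nhds (mem_chart_source E x)] with y hy
    simp only [metricCoord_apply, coordSymm_coord hy]
  have h1 := mdiff_metricCoord g x
  have h2 := mdiff_coord hσ
  have h3 := mdiff_coord hτ
  have hd : chartDeriv x (fun y ↦ metricCoord g x y (coord x y (σ y)) (coord x y (τ y)))
        (coord x x u) =
      dMetricCoord g x (coord x x u) (coord x x (σ x)) (coord x x (τ x)) +
      metricCoord g x x (chartDeriv x (fun y ↦ coord x y (σ y)) (coord x x u)) (coord x x (τ x)) +
      metricCoord g x x (coord x x (σ x)) (chartDeriv x (fun y ↦ coord x y (τ y)) (coord x x u)) := by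
    exact chartDeriv_bilin h1 h2 h3 _
  have hm : mvfderiv 𝓘(ℝ, E) (fun y ↦ g.inner y (σ y) (τ y)) x u =
      mvfderiv 𝓘(ℝ, E) (fun y ↦ metricCoord g x y (coord x y (σ y)) (coord x y (τ y))) x u := by
    have := hE.mfderiv_eq (I := 𝓘(ℝ, E)) (I' := 𝓘(ℝ, ℝ))
    exact congrArg (fun l ↦ l u) this
  have hc : ∀ a b : TangentSpace 𝓘(ℝ, E) x,
      g.inner x a b = metricCoord g x x (coord x x a) (coord x x b) := by
    intro a b
    simp only [metricCoord_apply, coordSymm_coord_self]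
  rw [hm, mvfderiv_eq_chartDeriv ((h1.clm_apply h2).clm_apply h3), hd, hc, hc, leviCivita_apply,
    leviCivita_apply]
  simp only [coord_coordSymm_self, map_add, add_apply]
  have hs : ∀ a b : E, metricCoord g x x a b = metricCoord g x x b a :=
    fun a b ↦ g.symm _ _ _
  rw [hs (coord x x (σ x)) (christoffel g x _ _), metricCoord_christoffel, metricCoord_christoffel,
    christoffelLower_apply, christoffelLower_apply,
    dMetricCoord_symm g x (coord x x u) (coord x x (τ x)),
    dMetricCoord_symm g x (coord x x (σ x)) (coord x x (τ x)),
    dMetricCoord_symm g x (coord x x (τ x)) (coord x x (σ x)) ]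
  ring


/-- The Levi-Civita connection is torsion free. -/
theorem leviCivita_torsion (g : RiemMetric E M) : (leviCivita g).torsion = 0 := by
  rw [CovariantDerivative.torsion_eq_zero_iff]
  intro X Y x hX hY
  rw [leviCivita_apply, leviCivita_apply, mlieBracket_coord, christoffel_symm g x (coord x x (X x)),
    ← map_sub]
  congr 1
  abel

end Connection

/-! ### Curvature, geodesics and Jacobi fields -/

section Geometry

variable {E : Type*} [NormedAddCommGroup E] [NormedSpace ℝ E]
  {M : Type*} [TopologicalSpace M] [ChartedSpace E M] [IsManifold 𝓘(ℝ, E) ∞ M]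

/-- The Riemann curvature tensor
`R(u, v)w = ∇_U ∇_V W - ∇_V ∇_U W - ∇_{[U, V]} W` at `x`, where `U`, `V`, `W` are the extensions of
`u`, `v`, `w` to vector fields with constant components in the preferred chart at `x`. -/
def curvature (g : RiemMetric E M) (x : M) (u v w : TangentSpace 𝓘(ℝ, E) x) :
    TangentSpace 𝓘(ℝ, E) x :=
  letI U : ∀ y : M, TangentSpace 𝓘(ℝ, E) y := FiberBundle.extend E u
  letI V : ∀ y : M, TangentSpace 𝓘(ℝ, E) y := FiberBundle.extend E v
  letI W : ∀ y : M, TangentSpace 𝓘(ℝ, E) y := FiberBundle.extend E w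
  leviCivita g (fun y ↦ leviCivita g W y (V y)) x u -
    leviCivita g (fun y ↦ leviCivita g W y (U y)) x v -
    leviCivita g W x (mlieBracket 𝓘(ℝ, E) U V x)

/-- A Riemannian manifold is flat if its curvature tensor vanishes identically. -/
def IsFlat (g : RiemMetric E M) : Prop :=
  ∀ (x : M) (u v w : TangentSpace 𝓘(ℝ, E) x), curvature g x u v w = 0

/-- The velocity vector `γ'(t)` of a curve. -/
def velocity (γ : ℝ → M) (t : ℝ) : TangentSpace 𝓘(ℝ, E) (γ t) :=
  mfderiv 𝓘(ℝ, ℝ) 𝓘(ℝ, E) γ t (1 : ℝ)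

/-- The covariant derivative `DV/dt = V' + Γ(γ', V)` at time `t` of a vector field `V` along the
curve `γ`, computed in the preferred chart at `γ t`. -/
def covDerivAlong (g : RiemMetric E M) (γ : ℝ → M) (V : ∀ t, TangentSpace 𝓘(ℝ, E) (γ t)) (t : ℝ) :
    TangentSpace 𝓘(ℝ, E) (γ t) :=
  coordSymm (γ t) (γ t) (deriv (fun s ↦ coord (γ t) (γ s) (V s)) t +
    christoffel g (γ t) (coord (γ t) (γ t) (V t)) (coord (γ t) (γ t) (velocity γ t)))

/-- A geodesic defined on the whole real line. -/
structure IsGeodesic (g : RiemMetric E M) (γ : ℝ → M) : Prop where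
  contMDiff : ContMDiff 𝓘(ℝ, ℝ) 𝓘(ℝ, E) ∞ γ
  geodesic_eq : ∀ t, covDerivAlong g γ (velocity γ) t = 0

/-- A unit speed geodesic. On a complete manifold `γ ↦ γ'(0)` identifies the unit speed geodesics
with the unit tangent bundle `SM`. -/
structure IsUnitSpeedGeodesic (g : RiemMetric E M) (γ : ℝ → M) : Prop
    extends IsGeodesic g γ where
  unit_speed : ∀ t, g.inner (γ t) (velocity γ t) (velocity γ t) = 1

/-- Geodesic completeness: every tangent vector is the initial velocity of a geodesic defined
on the whole real line. -/
def IsCompleteMetric (g : RiemMetric E M) : Prop :=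
  ∀ v : TangentBundle 𝓘(ℝ, E) M, ∃ γ : ℝ → M, IsGeodesic g γ ∧
    (⟨γ 0, velocity γ 0⟩ : TangentBundle 𝓘(ℝ, E) M) = v

/-- A Jacobi field along `γ`: a twice differentiable vector field with
`Y'' + R(Y, γ')γ' = 0`. -/
structure IsJacobiField (g : RiemMetric E M) (γ : ℝ → M)
    (Y : ∀ t, TangentSpace 𝓘(ℝ, E) (γ t)) : Prop where
  mdifferentiable : MDifferentiable 𝓘(ℝ, ℝ) (𝓘(ℝ, E).prod 𝓘(ℝ, E))
    (fun t ↦ (⟨γ t, Y t⟩ : TangentBundle 𝓘(ℝ, E) M))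
  mdifferentiable_deriv : MDifferentiable 𝓘(ℝ, ℝ) (𝓘(ℝ, E).prod 𝓘(ℝ, E))
    (fun t ↦ (⟨γ t, covDerivAlong g γ Y t⟩ : TangentBundle 𝓘(ℝ, E) M))
  jacobi_eq : ∀ t, covDerivAlong g γ (covDerivAlong g γ Y) t +
    curvature g (γ t) (Y t) (velocity γ t) (velocity γ t) = 0

/-- No conjugate points: a Jacobi field along a geodesic that vanishes at two distinct times is
identically zero. -/
def NoConjugatePoints (g : RiemMetric E M) : Prop :=
  ∀ γ : ℝ → M, IsUnitSpeedGeodesic g γ → ∀ Y, IsJacobiField g γ Y → Y 0 = 0 →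
    ∀ T, T ≠ 0 → Y T = 0 → ∀ t, Y t = 0

/-- No focal points: for every nontrivial Jacobi field `Y` along a geodesic with `Y(0) = 0`, one has
`d/dt ‖Y(t)‖² > 0` for all `t > 0`. -/
def NoFocalPoints (g : RiemMetric E M) : Prop :=
  ∀ γ : ℝ → M, IsUnitSpeedGeodesic g γ → ∀ Y, IsJacobiField g γ Y → Y 0 = 0 →
    covDerivAlong g γ Y 0 ≠ 0 →
    ∀ t, 0 < t → 0 < deriv (fun s ↦ g.inner (γ s) (Y s) (Y s)) t

/-! ### Stable Riccati solutions -/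

/-- The orthogonal complement `v^⊥` of `v = γ'(0)` in the tangent space at `γ 0`. -/
abbrev normalSpace (g : RiemMetric E M) (γ : ℝ → M) :
    Submodule ℝ (TangentSpace 𝓘(ℝ, E) (γ 0)) :=
  LinearMap.ker (g.inner (γ 0) (velocity γ 0)).toLinearMap

/-- `U` is the operator `U_T^s(v) = E_T'(0)` on `v^⊥`, where `v = γ'(0)` and `E_T` is the Jacobi
tensor along `γ` with `E_T(0) = Id` and `E_T(T) = 0`: that is, for `w ∈ v^⊥`, `U w = Y'(0)` for
a Jacobi field `Y` with `Y(0) = w` and `Y(T) = 0`. -/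
def IsRiccatiAt (g : RiemMetric E M) (γ : ℝ → M) (T : ℝ)
    (U : normalSpace g γ →ₗ[ℝ] normalSpace g γ) : Prop :=
  ∀ w : normalSpace g γ, ∃ Y, IsJacobiField g γ Y ∧ Y 0 = w ∧ Y T = 0 ∧
    covDerivAlong g γ Y 0 = U w

/-- `U` is the stable Riccati operator `U^s(v)`, the limit of `U_T^s(v)` as `T → ∞`,
where `v = γ'(0)`. -/
def IsStableRiccati (g : RiemMetric E M) (γ : ℝ → M)
    (U : normalSpace g γ →ₗ[ℝ] normalSpace g γ) : Prop :=
  ∃ UT : ℝ → (normalSpace g γ →ₗ[ℝ] normalSpace g γ),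
    (∀ T, 0 < T → IsRiccatiAt g γ T (UT T)) ∧
    ∀ w : normalSpace g γ, Tendsto (fun T ↦ UT T w) atTop (𝓝 (U w))

open Classical in
/-- The stable Riccati solution `U^s(v) : v^⊥ → v^⊥` for `v = γ'(0)`. On complete manifolds without
conjugate points it exists and is unique; the value `0` is used when there is none. -/
def stableRiccati (g : RiemMetric E M) (γ : ℝ → M) : normalSpace g γ →ₗ[ℝ] normalSpace g γ :=
  if h : ∃ U, IsStableRiccati g γ U then h.choose else 0

/-- The trace of `U^s(v)`, where `v = γ'(0)`. -/
def traceStable (g : RiemMetric E M) (γ : ℝ → M) : ℝ :=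
  LinearMap.trace ℝ (normalSpace g γ) (stableRiccati g γ)

/-- A complete Riemannian manifold without conjugate points is asymptotically harmonic if
`tr U^s` is constant on the unit tangent bundle. -/
structure IsAsymptoticallyHarmonic (g : RiemMetric E M) : Prop where
  complete : IsCompleteMetric g
  noConjugatePoints : NoConjugatePoints g
  trace_const : ∃ α : ℝ, ∀ γ : ℝ → M, IsUnitSpeedGeodesic g γ → traceStable g γ = α

end Geometry

end Riem

end

/-!
Why the manifold is flat. For a unit speed geodesic `γ` and `T > 0` let `U_T` be the operator on
`γ'(0)^⊥` that sends `w` to `Y'(0)`, where `Y` is the Jacobi field with `Y(0) = w` and `Y(T) = 0`.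

* Constancy of the Wronskian (`IsJacobiField.wronskian`) makes `U_T` symmetric. The
  absence of focal points, applied to the reversed geodesic, shows that `‖Y‖²` does not increase
  on `[0, T]`, so `U_T ≤ 0` (`IsRiccatiAt.nonpos`). Comparing the fields for `S ≤ T` by their Wronskian at time `S` gives
  `U_S ≤ U_T` (`IsRiccatiAt.mono`). Hence `U_T` converges as `T → ∞` (`exists_isStableRiccati`),
  and the limit is symmetric and negative semidefinite. Since its trace is `0`, it is `0`
  (`isStableRiccati_zero`).
* This holds along every unit speed geodesic, in particular along the shifted ones `s ↦ γ(s + t)`.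
  Let `Y` be the Jacobi field with `Y(0) = w` normal and `Y'(0) = 0`; it is the limit of the
  fields `Y_T` above. Another Wronskian identity, between `Y_T` and the field that starts at time
  `t` from `Y'(t)` and vanishes at `T`, passes to the limit `g(Y'(t), Y'(t)) = 0`
  (`covDerivAlong_jacobiSol_eq_zero`). So `Y` is parallel, and the Jacobi equation at time `0`
  reads `R(w, γ')γ' = 0`.
* By completeness `R(w, v)v = 0` for all `v` and `w`; polarization and the Bianchi identity give
  `R = 0` (`isFlat_of_curvature_eq_zero`).

The connection, the covariant derivative along a curve and the curvature are defined through the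
preferred chart at the point in question. To differentiate these expressions they are first
computed in a fixed chart (`leviCivita_eq`, `coord_covDerivAlong`, `coord_curvature`). There the
Koszul formula shows that the Christoffel symbols are smooth, and the symmetries of the curvature
tensor and the metric product rule (`hasDerivAt_inner`) follow from their symmetry and
compatibility with the metric. Jacobi fields with arbitrary initial data exist along a whole
geodesic because local solutions of a linear equation can be continued
(`IsLocalEvolution.exists_global`).
-/

set_option linter.unusedSectionVars false

noncomputable section

namespace Riem

/-! ### Changes of charts -/

section ChartChange

variable {E : Type*} [NormedAddCommGroup E] [NormedSpace ℝ E]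
  {M : Type*} [TopologicalSpace M] [ChartedSpace E M] [IsManifold 𝓘(ℝ, E) ∞ M]

/-- The transition map from the preferred chart at `x₀` to the preferred chart at `x₁`. -/
def transition (x₀ x₁ : M) (z : E) : E := chartAt E x₁ ((chartAt E x₀).symm z)

lemma eventually_mem_target {x₀ y : M} (hy : y ∈ (chartAt E x₀).source) :
    ∀ᶠ z in 𝓝 (chartAt E x₀ y), z ∈ (chartAt E x₀).target :=
  (chartAt E x₀).open_target.mem_nhds ((chartAt E x₀).map_source hy)

lemma eventually_symm_mem {x₀ x₁ y : M} (hy : y ∈ (chartAt E x₀).source)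
    (hy₁ : y ∈ (chartAt E x₁).source) :
    ∀ᶠ z in 𝓝 (chartAt E x₀ y), (chartAt E x₀).symm z ∈ (chartAt E x₁).source := by
  have h := (chartAt E x₀).continuousAt_symm ((chartAt E x₀).map_source hy)
  refine h.preimage_mem_nhds ((chartAt E x₁).open_source.mem_nhds ?_)
  rwa [(chartAt E x₀).left_inv hy]

lemma contDiffAt_transition {x₀ x₁ y : M} (hy : y ∈ (chartAt E x₀).source)
    (hy₁ : y ∈ (chartAt E x₁).source) :
    ContDiffAt ℝ ∞ (transition (E := E) x₀ x₁) (chartAt E x₀ y) := by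
  have h := contDiffWithinAt_ext_coord_change (I := 𝓘(ℝ, E)) (n := ∞) x₁ x₀
    (y := chartAt E x₀ y) (by simp [hy, hy₁])
  simp only [modelWithCornersSelf_coe, range_id, contDiffWithinAt_univ] at h
  exact h

/-- The coordinate changes of the tangent bundle are the derivatives of the transition maps. -/
lemma coord_coordSymm_eq {x₀ x₁ y : M} (hy : y ∈ (chartAt E x₀).source)
    (hy₁ : y ∈ (chartAt E x₁).source) (v : E) :
    coord x₁ y (coordSymm x₀ y v) = fderiv ℝ (transition (E := E) x₀ x₁) (chartAt E x₀ y) v := by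
  unfold coord coordSymm
  rw [TangentBundle.continuousLinearMapAt_trivializationAt_eq_core hy₁,
    TangentBundle.symmL_trivializationAt_eq_core hy]
  refine ((tangentBundleCore 𝓘(ℝ, E) M).coordChange_comp _ _ _ y
    (by exact ⟨⟨hy, mem_chart_source E y⟩, hy₁⟩) v).trans ?_
  rw [tangentBundleCore_coordChange_achart]
  simp only [modelWithCornersSelf_coe, range_id, fderivWithin_univ]
  rfl

/-- The derivative in the preferred chart at `y` may be computed in any other chart. -/
lemma chartDeriv_eq {F : Type*} [NormedAddCommGroup F] [NormedSpace ℝ F] {x₀ y : M}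
    (hy : y ∈ (chartAt E x₀).source) {f : M → F}
    (hf : DifferentiableAt ℝ (fun z ↦ f ((chartAt E x₀).symm z)) (chartAt E x₀ y))
    (u : TangentSpace 𝓘(ℝ, E) y) :
    chartDeriv y f (coord y y u) =
      fderiv ℝ (fun z ↦ f ((chartAt E x₀).symm z)) (chartAt E x₀ y) (coord x₀ y u) := by
  have hyy := mem_chart_source E y
  have e : (fun z ↦ f ((chartAt E y).symm z)) =ᶠ[𝓝 (chartAt E y y)]
      (fun z ↦ f ((chartAt E x₀).symm z)) ∘ transition y x₀ := by
    filter_upwards [eventually_symm_mem hyy hy] with z hz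
    simp [transition, (chartAt E x₀).left_inv hz]
  have ht : transition y x₀ (chartAt E y y) = chartAt E x₀ y := by
    simp [transition, (chartAt E y).left_inv hyy]
  unfold chartDeriv
  rw [e.fderiv_eq, fderiv_comp _ (by rwa [ht])
    ((contDiffAt_transition hyy hy).differentiableAt (by simp)), ht, ContinuousLinearMap.comp_apply,
    ← coord_coordSymm_eq hyy hy, coordSymm_coord_self]

/-- The components of a vector field in the preferred chart at `x₀`, as a function on the
model space. -/
def rep (x₀ : M) (σ : ∀ y : M, TangentSpace 𝓘(ℝ, E) y) (z : E) : E :=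
  coord x₀ ((chartAt E x₀).symm z) (σ ((chartAt E x₀).symm z))

lemma rep_chart {x₀ y : M} (hy : y ∈ (chartAt E x₀).source)
    (σ : ∀ y : M, TangentSpace 𝓘(ℝ, E) y) : rep x₀ σ (chartAt E x₀ y) = coord x₀ y (σ y) := by
  unfold rep
  rw [(chartAt E x₀).left_inv hy]

lemma coord_eq_fderiv_transition {x₀ x₁ y : M} (hy : y ∈ (chartAt E x₀).source)
    (hy₁ : y ∈ (chartAt E x₁).source) (v : TangentSpace 𝓘(ℝ, E) y) :
    coord x₁ y v = fderiv ℝ (transition (E := E) x₀ x₁) (chartAt E x₀ y) (coord x₀ y v) := by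
  rw [← coord_coordSymm_eq hy hy₁, coordSymm_coord hy]

lemma hasFDerivAt_fderiv_transition {x₀ x₁ y : M} (hy : y ∈ (chartAt E x₀).source)
    (hy₁ : y ∈ (chartAt E x₁).source) :
    HasFDerivAt (fderiv ℝ (transition (E := E) x₀ x₁))
      (fderiv ℝ (fderiv ℝ (transition (E := E) x₀ x₁)) (chartAt E x₀ y)) (chartAt E x₀ y) :=
  ((contDiffAt_transition hy hy₁).fderiv_right (m := 1) (by exact WithTop.coe_le_coe.2 le_top)
    |>.differentiableAt (by simp)).hasFDerivAt

lemma fderiv_fderiv_transition_symm {x₀ x₁ y : M} (hy : y ∈ (chartAt E x₀).source)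
    (hy₁ : y ∈ (chartAt E x₁).source) (u v : E) :
    fderiv ℝ (fderiv ℝ (transition (E := E) x₀ x₁)) (chartAt E x₀ y) u v =
      fderiv ℝ (fderiv ℝ (transition (E := E) x₀ x₁)) (chartAt E x₀ y) v u :=
  ((contDiffAt_transition hy hy₁).isSymmSndFDerivAt
    (by simp; exact WithTop.coe_le_coe.2 le_top)) u v

lemma contMDiffAt_chart_symm {x₀ y : M} (hy : y ∈ (chartAt E x₀).source) :
    ContMDiffAt 𝓘(ℝ, E) 𝓘(ℝ, E) ∞ (chartAt E x₀).symm (chartAt E x₀ y) :=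
  contMDiffOn_chart_symm.contMDiffAt
    ((chartAt E x₀).open_target.mem_nhds ((chartAt E x₀).map_source hy))

lemma contMDiffAt_chart {x₀ y : M} (hy : y ∈ (chartAt E x₀).source) :
    ContMDiffAt 𝓘(ℝ, E) 𝓘(ℝ, E) ∞ (chartAt E x₀) y :=
  contMDiffOn_chart.contMDiffAt ((chartAt E x₀).open_source.mem_nhds hy)

lemma differentiableAt_comp_symm {F : Type*} [NormedAddCommGroup F] [NormedSpace ℝ F] {x₀ y : M}
    (hy : y ∈ (chartAt E x₀).source) {f : M → F} (h : MDifferentiableAt 𝓘(ℝ, E) 𝓘(ℝ, F) f y) :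
    DifferentiableAt ℝ (fun z ↦ f ((chartAt E x₀).symm z)) (chartAt E x₀ y) := by
  rw [← mdifferentiableAt_iff_differentiableAt]
  exact MDifferentiableAt.comp (chartAt E x₀ y) (by rwa [(chartAt E x₀).left_inv hy])
    ((contMDiffAt_chart_symm hy).mdifferentiableAt (by simp))

lemma mdifferentiableAt_of_comp_symm {F : Type*} [NormedAddCommGroup F] [NormedSpace ℝ F]
    {x₀ y : M} (hy : y ∈ (chartAt E x₀).source) {f : M → F}
    (h : DifferentiableAt ℝ (fun z ↦ f ((chartAt E x₀).symm z)) (chartAt E x₀ y)) :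
    MDifferentiableAt 𝓘(ℝ, E) 𝓘(ℝ, F) f y := by
  rw [← mdifferentiableAt_iff_differentiableAt] at h
  refine (MDifferentiableAt.comp y h
    ((contMDiffAt_chart hy).mdifferentiableAt (by simp))).congr_of_eventuallyEq ?_
  filter_upwards [(chartAt E x₀).open_source.mem_nhds hy] with y' hy'
  simp [(chartAt E x₀).left_inv hy']

lemma contDiffAt_comp_symm {F : Type*} [NormedAddCommGroup F] [NormedSpace ℝ F] {x₀ y : M}
    (hy : y ∈ (chartAt E x₀).source) {f : M → F} (h : ContMDiffAt 𝓘(ℝ, E) 𝓘(ℝ, F) ∞ f y) :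
    ContDiffAt ℝ ∞ (fun z ↦ f ((chartAt E x₀).symm z)) (chartAt E x₀ y) := by
  rw [← contMDiffAt_iff_contDiffAt]
  exact ContMDiffAt.comp (chartAt E x₀ y) (by rwa [(chartAt E x₀).left_inv hy])
    (contMDiffAt_chart_symm hy)

lemma coord_eventuallyEq {x₀ y : M} (hy : y ∈ (chartAt E x₀).source)
    (σ : ∀ y : M, TangentSpace 𝓘(ℝ, E) y) :
    (fun y ↦ coord x₀ y (σ y)) =ᶠ[𝓝 y]
      fun y ↦ (trivializationAt E (TangentSpace 𝓘(ℝ, E)) x₀ ⟨y, σ y⟩).2 := by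
  filter_upwards [(chartAt E x₀).open_source.mem_nhds hy] with y hy
  simp [coord, Trivialization.continuousLinearMapAt_apply, Trivialization.linearMapAt_apply, hy]

lemma mdifferentiableAt_iff_rep {x₀ y : M} (hy : y ∈ (chartAt E x₀).source)
    (σ : ∀ y : M, TangentSpace 𝓘(ℝ, E) y) :
    MDiffAt (T% σ) y ↔ DifferentiableAt ℝ (rep x₀ σ) (chartAt E x₀ y) := by
  have h := (trivializationAt E (TangentSpace 𝓘(ℝ, E)) x₀).mdifferentiableAt_section_iff
    𝓘(ℝ, E) σ (b₀ := y) (by simpa using hy)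
  rw [h]
  exact ⟨fun h' ↦ differentiableAt_comp_symm (f := fun y ↦ coord x₀ y (σ y)) hy
      (h'.congr_of_eventuallyEq (coord_eventuallyEq hy σ)),
    fun h' ↦ (mdifferentiableAt_of_comp_symm (f := fun y ↦ coord x₀ y (σ y)) hy
      h').congr_of_eventuallyEq (coord_eventuallyEq hy σ).symm⟩

lemma contDiffAt_rep {x₀ y : M} (hy : y ∈ (chartAt E x₀).source)
    {σ : ∀ y : M, TangentSpace 𝓘(ℝ, E) y} (h : CMDiffAt ∞ (T% σ) y) :
    ContDiffAt ℝ ∞ (rep x₀ σ) (chartAt E x₀ y) := by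
  rw [(trivializationAt E (TangentSpace 𝓘(ℝ, E)) x₀).contMDiffAt_section_iff
    (by simpa using hy)] at h
  exact contDiffAt_comp_symm (f := fun y ↦ coord x₀ y (σ y)) hy
    (h.congr_of_eventuallyEq (coord_eventuallyEq hy σ))

/-- The vector field with constant components `w` in the preferred chart at `x₀`. -/
def constField (x₀ : M) (w : E) (y : M) : TangentSpace 𝓘(ℝ, E) y := coordSymm x₀ y w

lemma rep_constField {x₀ : M} {z : E} (hz : z ∈ (chartAt E x₀).target) (w : E) :
    rep x₀ (constField x₀ w) z = w :=
  coord_coordSymm ((chartAt E x₀).map_target hz) w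

/-- The Christoffel symbols at `y` in the preferred chart at `x₀`, obtained from those in the
preferred chart at `y` by the transformation law. -/
def chr (g : RiemMetric E M) (x₀ y : M) (u w : E) : E :=
  coord x₀ y (coordSymm y y (fderiv ℝ (fderiv ℝ (transition (E := E) x₀ y)) (chartAt E x₀ y) u w +
    christoffel g y (coord y y (coordSymm x₀ y w)) (coord y y (coordSymm x₀ y u))))

/-- The formula `∇_u σ = dσ(u) + Γ(u, σ)` in an arbitrary chart. The definition of `leviCivita`
uses the chart at the point itself; this version, in which the chart stays fixed while the point
moves, is the one that can be differentiated again. -/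
lemma leviCivita_eq (g : RiemMetric E M) {x₀ y : M} (hy : y ∈ (chartAt E x₀).source)
    {σ : ∀ y : M, TangentSpace 𝓘(ℝ, E) y}
    (hσ : DifferentiableAt ℝ (rep x₀ σ) (chartAt E x₀ y)) (u : TangentSpace 𝓘(ℝ, E) y) :
    coord x₀ y (leviCivita g σ y u) =
      fderiv ℝ (rep x₀ σ) (chartAt E x₀ y) (coord x₀ y u) +
        chr g x₀ y (coord x₀ y u) (coord x₀ y (σ y)) := by
  have hyy := mem_chart_source E y
  have e : (fun z ↦ coord y ((chartAt E x₀).symm z) (σ ((chartAt E x₀).symm z)))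
      =ᶠ[𝓝 (chartAt E x₀ y)] fun z ↦ fderiv ℝ (transition x₀ y) z (rep x₀ σ z) := by
    filter_upwards [eventually_symm_mem hy hyy, eventually_mem_target hy] with z hz hz'
    have := coord_eq_fderiv_transition ((chartAt E x₀).map_target hz') hz
      (σ ((chartAt E x₀).symm z))
    rwa [(chartAt E x₀).right_inv hz'] at this
  have hd := (hasFDerivAt_fderiv_transition hy hyy).clm_apply hσ.hasFDerivAt
  have hd' := hd.congr_of_eventuallyEq e
  rw [leviCivita_apply, chartDeriv_eq (f := fun y' ↦ coord y y' (σ y')) hy hd'.differentiableAt,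
    hd'.fderiv]
  have h1 : ∀ v : E,
      coord x₀ y (coordSymm y y (fderiv ℝ (transition x₀ y) (chartAt E x₀ y) v)) = v := by
    intro v
    rw [← coord_coordSymm_eq hy hyy, coordSymm_coord_self, coord_coordSymm hy]
  simp only [add_apply, ContinuousLinearMap.comp_apply, ContinuousLinearMap.flip_apply, map_add, h1,
    chr, coordSymm_coord hy, rep_chart hy]
  abel

end ChartChange

/-! ### The metric and the Christoffel symbols in a chart -/

section LocalMetric

variable {E : Type*} [NormedAddCommGroup E] [NormedSpace ℝ E]
  {M : Type*} [TopologicalSpace M] [ChartedSpace E M] [IsManifold 𝓘(ℝ, E) ∞ M]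

/-- The components of the metric in the preferred chart at `x₀`, as a function on the model
space. -/
def gm (g : RiemMetric E M) (x₀ : M) (z : E) : E →L[ℝ] E →L[ℝ] ℝ :=
  metricCoord g x₀ ((chartAt E x₀).symm z)

lemma gm_chart (g : RiemMetric E M) {x₀ y : M} (hy : y ∈ (chartAt E x₀).source) :
    gm g x₀ (chartAt E x₀ y) = metricCoord g x₀ y := by
  rw [gm, (chartAt E x₀).left_inv hy]

lemma inner_eq_gm (g : RiemMetric E M) {x₀ y : M} (hy : y ∈ (chartAt E x₀).source)
    (a b : TangentSpace 𝓘(ℝ, E) y) :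
    g.inner y a b = gm g x₀ (chartAt E x₀ y) (coord x₀ y a) (coord x₀ y b) := by
  rw [gm_chart g hy, metricCoord_apply, coordSymm_coord hy, coordSymm_coord hy]

lemma gm_symm (g : RiemMetric E M) (x₀ : M) (z a b : E) : gm g x₀ z a b = gm g x₀ z b a :=
  g.symm _ _ _

set_option synthInstance.maxHeartbeats 400000 in
lemma contDiffAt_gm (g : RiemMetric E M) {x₀ y : M} (hy : y ∈ (chartAt E x₀).source) :
    ContDiffAt ℝ ∞ (gm g x₀) (chartAt E x₀ y) := by
  have h := g.contMDiff y
  rw [(trivializationAt (E →L[ℝ] E →L[ℝ] ℝ) (fun x : M ↦ TangentSpace 𝓘(ℝ, E) x →L[ℝ]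
    TangentSpace 𝓘(ℝ, E) x →L[ℝ] ℝ) x₀).contMDiffAt_section_iff (by simpa using hy)] at h
  refine contDiffAt_comp_symm (f := metricCoord g x₀) hy (h.congr_of_eventuallyEq ?_)
  filter_upwards [(chartAt E x₀).open_source.mem_nhds hy] with y hy
  ext u w
  simp [metricCoord, hom_trivializationAt_apply, ContinuousLinearMap.inCoordinates, coordSymm,
    Trivialization.linearMapAt_apply, hy]

lemma gm_pos (g : RiemMetric E M) {x₀ y : M} (hy : y ∈ (chartAt E x₀).source) {a : E}
    (ha : a ≠ 0) : 0 < gm g x₀ (chartAt E x₀ y) a a := by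
  rw [gm_chart g hy, metricCoord_apply]
  refine g.pos y _ fun h ↦ ha ?_
  rw [← coord_coordSymm hy a, h, map_zero]

lemma mdifferentiableAt_constField {x₀ y : M} (hy : y ∈ (chartAt E x₀).source) (w : E) :
    MDiffAt (T% (constField (E := E) x₀ w)) y := by
  rw [mdifferentiableAt_iff_rep hy]
  refine (differentiableAt_const w).congr_of_eventuallyEq ?_
  filter_upwards [eventually_mem_target hy] with z hz using rep_constField hz w

lemma leviCivita_constField (g : RiemMetric E M) {x₀ y : M} (hy : y ∈ (chartAt E x₀).source)
    (u w : E) :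
    coord x₀ y (leviCivita g (constField x₀ w) y (coordSymm x₀ y u)) = chr g x₀ y u w := by
  have e : rep x₀ (constField x₀ w) =ᶠ[𝓝 (chartAt E x₀ y)] fun _ : E ↦ w := by
    filter_upwards [eventually_mem_target hy] with z hz using rep_constField hz w
  have h := (mdifferentiableAt_iff_rep hy _).1 (mdifferentiableAt_constField hy w)
  rw [leviCivita_eq g hy h, e.fderiv_eq, coord_coordSymm hy, constField, coord_coordSymm hy]
  simp

variable [FiniteDimensional ℝ E]

/-- The Christoffel symbols are compatible with the metric. The connection is already known to be
metric (`leviCivita_metric`); here this is read off for fields with constant components. -/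
lemma fderiv_gm (g : RiemMetric E M) {x₀ y : M} (hy : y ∈ (chartAt E x₀).source)
    (u a b : E) : fderiv ℝ (fun z ↦ gm g x₀ z a b) (chartAt E x₀ y) u =
      gm g x₀ (chartAt E x₀ y) (chr g x₀ y u a) b + gm g x₀ (chartAt E x₀ y) a (chr g x₀ y u b) := by
  have h := leviCivita_metric g (mdifferentiableAt_constField hy a)
    (mdifferentiableAt_constField hy b)
    (coordSymm x₀ y u)
  have hd : DifferentiableAt ℝ (fun z ↦ gm g x₀ z a b) (chartAt E x₀ y) :=
    (((contDiffAt_gm g hy).differentiableAt (by simp)).clm_apply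
      (differentiableAt_const a)).clm_apply (differentiableAt_const b)
  have hm := mdifferentiableAt_of_comp_symm (f := fun y' ↦ g.inner y' (constField x₀ a y')
    (constField x₀ b y')) hy hd
  rw [mvfderiv_eq_chartDeriv hm, chartDeriv_eq (f := fun y' ↦ g.inner y' (constField x₀ a y')
    (constField x₀ b y')) hy hd, coord_coordSymm hy, inner_eq_gm g hy, inner_eq_gm g hy,
    leviCivita_constField g hy, leviCivita_constField g hy, constField, constField,
    coord_coordSymm hy, coord_coordSymm hy] at h
  rw [← h]
  rfl

lemma chr_symm (g : RiemMetric E M) {x₀ y : M} (hy : y ∈ (chartAt E x₀).source) (u w : E) :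
    chr g x₀ y u w = chr g x₀ y w u := by
  unfold chr
  rw [fderiv_fderiv_transition_symm hy (mem_chart_source E y), christoffel_symm]

/-- The Koszul formula. -/
lemma gm_chr (g : RiemMetric E M) {x₀ y : M} (hy : y ∈ (chartAt E x₀).source) (u w v : E) :
    gm g x₀ (chartAt E x₀ y) (chr g x₀ y u w) v = 1 / 2 *
      (fderiv ℝ (fun z ↦ gm g x₀ z w v) (chartAt E x₀ y) u +
        fderiv ℝ (fun z ↦ gm g x₀ z u v) (chartAt E x₀ y) w -
        fderiv ℝ (fun z ↦ gm g x₀ z u w) (chartAt E x₀ y) v) := by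
  rw [fderiv_gm g hy, fderiv_gm g hy, fderiv_gm g hy, chr_symm g hy w u, chr_symm g hy v u,
    chr_symm g hy v w, gm_symm g x₀ _ u, gm_symm g x₀ _ w]
  ring

lemma chr_add_left (g : RiemMetric E M) (x₀ y : M) (u u' w : E) :
    chr g x₀ y (u + u') w = chr g x₀ y u w + chr g x₀ y u' w := by
  simp only [chr, map_add, add_apply]
  abel

lemma chr_smul_left (g : RiemMetric E M) (x₀ y : M) (c : ℝ) (u w : E) :
    chr g x₀ y (c • u) w = c • chr g x₀ y u w := by
  simp only [chr, map_add, smul_add, map_smul, smul_apply]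

lemma chr_add_right (g : RiemMetric E M) (x₀ y : M) (u w w' : E) :
    chr g x₀ y u (w + w') = chr g x₀ y u w + chr g x₀ y u w' := by
  simp only [chr, map_add, christoffel_add, add_apply]
  abel

lemma chr_smul_right (g : RiemMetric E M) (x₀ y : M) (c : ℝ) (u w : E) :
    chr g x₀ y u (c • w) = c • chr g x₀ y u w := by
  simp only [chr, map_add, smul_add, map_smul, christoffel_smul, smul_apply]

/-- The Christoffel symbols in the preferred chart at `x₀`, as a function on the model space. -/
def Gam (g : RiemMetric E M) (x₀ : M) (z : E) : E →L[ℝ] E →L[ℝ] E :=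
  LinearMap.toContinuousBilinearMap (LinearMap.mk₂ ℝ (chr g x₀ ((chartAt E x₀).symm z))
    (chr_add_left g _ _) (chr_smul_left g _ _) (chr_add_right g _ _)
    (fun c ↦ chr_smul_right g _ _ c))

lemma Gam_apply (g : RiemMetric E M) (x₀ : M) (z u w : E) :
    Gam g x₀ z u w = chr g x₀ ((chartAt E x₀).symm z) u w := rfl

lemma chr_eq_Gam (g : RiemMetric E M) {x₀ y : M} (hy : y ∈ (chartAt E x₀).source) (u w : E) :
    chr g x₀ y u w = Gam g x₀ (chartAt E x₀ y) u w := by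
  rw [Gam_apply, (chartAt E x₀).left_inv hy]

/-- The Gram matrix of the metric is invertible. -/
lemma gm_equiv (g : RiemMetric E M) {x₀ y : M} (hy : y ∈ (chartAt E x₀).source) :
    ∃ e : E ≃L[ℝ] (E →L[ℝ] ℝ), (e : E →L[ℝ] (E →L[ℝ] ℝ)) = gm g x₀ (chartAt E x₀ y) := by
  have hinj : Function.Injective (gm g x₀ (chartAt E x₀ y)) := by
    rw [injective_iff_map_eq_zero]
    intro a ha
    by_contra hne
    have := gm_pos g hy hne
    simp [ha] at this
  have hfr : Module.finrank ℝ E = Module.finrank ℝ (E →L[ℝ] ℝ) := by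
    rw [← (LinearMap.toContinuousLinearMap (𝕜 := ℝ) (E := E) (F' := ℝ)).finrank_eq]
    exact Subspace.dual_finrank_eq.symm
  have hb : Function.Bijective (gm g x₀ (chartAt E x₀ y)) :=
    ⟨hinj, (LinearMap.injective_iff_surjective_of_finrank_eq_finrank hfr
      (f := (gm g x₀ (chartAt E x₀ y)).toLinearMap)).1 hinj⟩
  exact ⟨(LinearEquiv.ofBijective (gm g x₀ (chartAt E x₀ y)).toLinearMap
    hb).toContinuousLinearEquiv, by ext; rfl⟩

lemma exists_chart_eq {x₀ : M} {z : E} (hz : z ∈ (chartAt E x₀).target) :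
    ∃ y ∈ (chartAt E x₀).source, chartAt E x₀ y = z :=
  ⟨_, (chartAt E x₀).map_target hz, (chartAt E x₀).right_inv hz⟩

lemma Gam_symm (g : RiemMetric E M) {x₀ : M} {z : E} (hz : z ∈ (chartAt E x₀).target) (u w : E) :
    Gam g x₀ z u w = Gam g x₀ z w u :=
  chr_symm g ((chartAt E x₀).map_target hz) u w

/-- The metric is parallel, in the preferred chart at `x₀`. -/
lemma fderiv_gm_eq (g : RiemMetric E M) {x₀ : M} {z : E} (hz : z ∈ (chartAt E x₀).target)
    (u a b : E) : fderiv ℝ (fun z ↦ gm g x₀ z a b) z u =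
      gm g x₀ z (Gam g x₀ z u a) b + gm g x₀ z a (Gam g x₀ z u b) := by
  obtain ⟨y, hy, rfl⟩ := exists_chart_eq hz
  rw [fderiv_gm g hy, chr_eq_Gam g hy, chr_eq_Gam g hy]

lemma contDiffOn_gm (g : RiemMetric E M) (x₀ : M) :
    ContDiffOn ℝ ∞ (gm g x₀) (chartAt E x₀).target := by
  intro z hz
  obtain ⟨y, hy, rfl⟩ := exists_chart_eq hz
  exact (contDiffAt_gm g hy).contDiffWithinAt

/-- The Christoffel symbols are smooth on the whole chart domain. The definition gives them
pointwise, each time through another chart, so smoothness is obtained from the Koszul formula. -/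
lemma contDiffOn_Gam (g : RiemMetric E M) (x₀ : M) :
    ContDiffOn ℝ ∞ (Gam g x₀) (chartAt E x₀).target := by
  rw [contDiffOn_clm_apply]
  intro u
  rw [contDiffOn_clm_apply]
  intro w
  have hs : ∀ u w v : E, ContDiffOn ℝ ∞ (fun z ↦ fderiv ℝ (fun z ↦ gm g x₀ z w v) z u)
      (chartAt E x₀).target := fun u w v ↦
    ((((contDiffOn_gm g x₀).clm_apply contDiffOn_const).clm_apply
      contDiffOn_const).fderiv_of_isOpen (chartAt E x₀).open_target
      (m := ∞) (by simp)).clm_apply contDiffOn_const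
  -- lowering the index gives the right-hand side of the Koszul formula, which is smooth
  have hlow : ContDiffOn ℝ ∞ (fun z ↦ gm g x₀ z (Gam g x₀ z u w)) (chartAt E x₀).target := by
    rw [contDiffOn_clm_apply]
    intro v
    refine (((hs u w v).add (hs w u v)).sub (hs v u w)).const_smul (1 / 2 : ℝ) |>.congr ?_
    intro z hz
    obtain ⟨y, hy, rfl⟩ := exists_chart_eq hz
    rw [← chr_eq_Gam g hy]
    exact gm_chr g hy u w v
  have h1 : ContDiffOn ℝ ∞ (fun z ↦ (gm g x₀ z).inverse) (chartAt E x₀).target := by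
    intro z hz
    obtain ⟨y, hy, rfl⟩ := exists_chart_eq hz
    obtain ⟨e, he⟩ := gm_equiv g hy
    refine (ContDiffAt.comp (chartAt E x₀ y) (g := ContinuousLinearMap.inverse) ?_
      (contDiffAt_gm g hy)).contDiffWithinAt
    rw [← he]
    exact contDiffAt_map_inverse e
  refine (h1.clm_apply hlow).congr fun z hz ↦ ?_
  obtain ⟨y, hy, rfl⟩ := exists_chart_eq hz
  obtain ⟨e, he⟩ := gm_equiv g hy
  rw [← he]
  simp

end LocalMetric

/-! ### The curvature tensor in a chart -/

section LocalCurvature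

variable {E : Type*} [NormedAddCommGroup E] [NormedSpace ℝ E]
  {M : Type*} [TopologicalSpace M] [ChartedSpace E M] [IsManifold 𝓘(ℝ, E) ∞ M]
  [FiniteDimensional ℝ E]

/-- The components of the curvature tensor in the preferred chart at `x₀`, as a function on the
model space. -/
def Rm (g : RiemMetric E M) (x₀ : M) (z u v w : E) : E :=
  fderiv ℝ (Gam g x₀) z u v w - fderiv ℝ (Gam g x₀) z v u w +
    Gam g x₀ z u (Gam g x₀ z v w) - Gam g x₀ z v (Gam g x₀ z u w)

lemma hasFDerivAt_Gam (g : RiemMetric E M) {x₀ : M} {z : E} (hz : z ∈ (chartAt E x₀).target) :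
    HasFDerivAt (Gam g x₀) (fderiv ℝ (Gam g x₀) z) z :=
  (((contDiffOn_Gam g x₀).contDiffAt
    ((chartAt E x₀).open_target.mem_nhds hz)).differentiableAt (by simp)).hasFDerivAt

/-- The components of `∇_V W`. -/
lemma rep_leviCivita (g : RiemMetric E M) {x₀ : M} {z : E} (hz : z ∈ (chartAt E x₀).target)
    {V W : ∀ y : M, TangentSpace 𝓘(ℝ, E) y} (hW : DifferentiableAt ℝ (rep x₀ W) z) :
    rep x₀ (fun y ↦ leviCivita g W y (V y)) z =
      fderiv ℝ (rep x₀ W) z (rep x₀ V z) + Gam g x₀ z (rep x₀ V z) (rep x₀ W z) := by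
  obtain ⟨y, hy, rfl⟩ := exists_chart_eq hz
  rw [rep_chart hy, leviCivita_eq g hy hW, chr_eq_Gam g hy, rep_chart hy, rep_chart hy]

set_option synthInstance.maxHeartbeats 200000 in
/-- The components of `∇_U ∇_V W`. -/
lemma rep_leviCivita_leviCivita (g : RiemMetric E M) {x₀ : M} {z : E}
    (hz : z ∈ (chartAt E x₀).target) {U V W : ∀ y : M, TangentSpace 𝓘(ℝ, E) y}
    (hV : DifferentiableAt ℝ (rep x₀ V) z) (hW : ContDiffAt ℝ ∞ (rep x₀ W) z) :
    rep x₀ (fun y ↦ leviCivita g (fun y ↦ leviCivita g W y (V y)) y (U y)) z =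
      fderiv ℝ (fderiv ℝ (rep x₀ W)) z (rep x₀ U z) (rep x₀ V z) +
      fderiv ℝ (rep x₀ W) z (fderiv ℝ (rep x₀ V) z (rep x₀ U z)) +
      fderiv ℝ (Gam g x₀) z (rep x₀ U z) (rep x₀ V z) (rep x₀ W z) +
      Gam g x₀ z (fderiv ℝ (rep x₀ V) z (rep x₀ U z)) (rep x₀ W z) +
      Gam g x₀ z (rep x₀ V z) (fderiv ℝ (rep x₀ W) z (rep x₀ U z)) +
      Gam g x₀ z (rep x₀ U z) (fderiv ℝ (rep x₀ W) z (rep x₀ V z) +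
        Gam g x₀ z (rep x₀ V z) (rep x₀ W z)) := by
  have e : rep x₀ (fun y ↦ leviCivita g W y (V y)) =ᶠ[𝓝 z] fun z ↦
      fderiv ℝ (rep x₀ W) z (rep x₀ V z) + Gam g x₀ z (rep x₀ V z) (rep x₀ W z) := by
    filter_upwards [(chartAt E x₀).open_target.mem_nhds hz,
      (hW.of_le (m := 1) (by simp)).eventually (WithTop.coe_injective.ne ENat.one_ne_top)]
      with z' hz' hW'
    exact rep_leviCivita g hz' (hW'.differentiableAt (by simp))
  have hW1 := (hW.differentiableAt (by simp)).hasFDerivAt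
  have hW2 := ((hW.fderiv_right (m := 1) (by exact WithTop.coe_le_coe.2 le_top)).differentiableAt
    (by simp)).hasFDerivAt
  have hd := ((hW2.clm_apply hV.hasFDerivAt).add
    (((hasFDerivAt_Gam g hz).clm_apply hV.hasFDerivAt).clm_apply hW1)).congr_of_eventuallyEq e
  rw [rep_leviCivita g hz hd.differentiableAt, hd.fderiv, e.eq_of_nhds]
  simp only [add_apply, ContinuousLinearMap.comp_apply, ContinuousLinearMap.flip_apply]
  abel

/-- The curvature tensor, computed in an arbitrary chart. -/
lemma coord_curvature (g : RiemMetric E M) {x₀ y : M} (hy : y ∈ (chartAt E x₀).source)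
    (u v w : TangentSpace 𝓘(ℝ, E) y) :
    coord x₀ y (curvature g y u v w) =
      Rm g x₀ (chartAt E x₀ y) (coord x₀ y u) (coord x₀ y v) (coord x₀ y w) := by
  have hz := (chartAt E x₀).map_source hy
  have key : ∀ v : TangentSpace 𝓘(ℝ, E) y, ∃ V : ∀ y : M, TangentSpace 𝓘(ℝ, E) y,
      V = FiberBundle.extend E v ∧ MDiffAt (T% V) y ∧
        ContDiffAt ℝ ∞ (rep x₀ V) (chartAt E x₀ y) ∧
        rep x₀ V (chartAt E x₀ y) = coord x₀ y v := by
    intro v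
    have h := FiberBundle.contMDiffAt_extend (k := ∞) 𝓘(ℝ, E) E v
    exact ⟨_, rfl, h.mdifferentiableAt (by simp), contDiffAt_rep hy h, by
      rw [rep_chart hy, FiberBundle.extend_apply_self]⟩
  obtain ⟨U, hU, hU0, hU1, hU2⟩ := key u
  obtain ⟨V, hV, hV0, hV1, hV2⟩ := key v
  obtain ⟨W, hW, hW0, hW1, hW2⟩ := key w
  have hUu : U y = u := by rw [hU, FiberBundle.extend_apply_self]
  have hVv : V y = v := by rw [hV, FiberBundle.extend_apply_self]
  have hc : curvature g y u v w = leviCivita g (fun y ↦ leviCivita g W y (V y)) y (U y) -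
      leviCivita g (fun y ↦ leviCivita g W y (U y)) y (V y) -
      leviCivita g W y (leviCivita g V y (U y) - leviCivita g U y (V y)) := by
    rw [(CovariantDerivative.torsion_eq_zero_iff (leviCivita g)).1 (leviCivita_torsion g) hU0 hV0]
    simp only [curvature, ← hU, ← hV, ← hW, hUu, hVv]
  have hUd := hU1.differentiableAt (by simp)
  have hVd := hV1.differentiableAt (by simp)
  have hWd := hW1.differentiableAt (by simp)
  have h1 := rep_leviCivita_leviCivita g hz (U := U) hVd hW1
  have h2 := rep_leviCivita_leviCivita g hz (U := V) hUd hW1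
  have h3 := rep_leviCivita g hz (V := fun y ↦ leviCivita g V y (U y) - leviCivita g U y (V y)) hWd
  have h4 := rep_leviCivita g hz (V := U) hVd
  have h5 := rep_leviCivita g hz (V := V) hUd
  rw [rep_chart hy] at h1 h2 h3 h4 h5
  have h6 := rep_chart hy (fun y ↦ leviCivita g V y (U y) - leviCivita g U y (V y))
  rw [hc, map_sub, map_sub, h1, h2, h3, h6, map_sub, h4, h5,
    (hW1.isSymmSndFDerivAt (by simp; exact WithTop.coe_le_coe.2 le_top))
      (rep x₀ V (chartAt E x₀ y)) (rep x₀ U (chartAt E x₀ y)),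
    Gam_symm g hz (rep x₀ V (chartAt E x₀ y)) (rep x₀ U (chartAt E x₀ y)), hU2, hV2, hW2, Rm]
  simp only [map_add, map_sub, sub_apply, add_apply]
  abel

lemma Rm_antisymm (g : RiemMetric E M) (x₀ : M) (z u v w : E) :
    Rm g x₀ z u v w = - Rm g x₀ z v u w := by
  unfold Rm
  abel

set_option synthInstance.maxHeartbeats 200000 in
lemma fderiv_Gam_symm (g : RiemMetric E M) {x₀ : M} {z : E} (hz : z ∈ (chartAt E x₀).target)
    (u v w : E) : fderiv ℝ (Gam g x₀) z u v w = fderiv ℝ (Gam g x₀) z u w v := by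
  have h : ∀ v w, HasFDerivAt (fun z ↦ Gam g x₀ z v w) _ z := fun v w ↦
    (((hasFDerivAt_Gam g hz).clm_apply (hasFDerivAt_const v _)).clm_apply (hasFDerivAt_const w _))
  have e : (fun z ↦ Gam g x₀ z v w) =ᶠ[𝓝 z] fun z ↦ Gam g x₀ z w v := by
    filter_upwards [(chartAt E x₀).open_target.mem_nhds hz] with z hz using Gam_symm g hz v w
  have := congrArg (fun l ↦ l u) ((h v w).unique ((h w v).congr_of_eventuallyEq e))
  simpa using this

lemma Rm_bianchi (g : RiemMetric E M) {x₀ : M} {z : E} (hz : z ∈ (chartAt E x₀).target)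
    (u v w : E) : Rm g x₀ z u v w + Rm g x₀ z v w u + Rm g x₀ z w u v = 0 := by
  unfold Rm
  rw [fderiv_Gam_symm g hz u w v, fderiv_Gam_symm g hz v u w, fderiv_Gam_symm g hz w v u,
    Gam_symm g hz w v, Gam_symm g hz w u, Gam_symm g hz v u]
  abel

set_option synthInstance.maxHeartbeats 200000 in
/-- The second derivatives of the metric, from differentiating the equation `∇ g = 0`. -/
lemma fderiv_fderiv_gm (g : RiemMetric E M) {x₀ : M} {z : E} (hz : z ∈ (chartAt E x₀).target)
    (u v a b : E) :
    fderiv ℝ (fderiv ℝ (fun z ↦ gm g x₀ z a b)) z v u =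
      gm g x₀ z (Gam g x₀ z v (Gam g x₀ z u a)) b + gm g x₀ z (Gam g x₀ z u a) (Gam g x₀ z v b) +
      gm g x₀ z (fderiv ℝ (Gam g x₀) z v u a) b +
      (gm g x₀ z (Gam g x₀ z v a) (Gam g x₀ z u b) + gm g x₀ z a (Gam g x₀ z v (Gam g x₀ z u b)) +
      gm g x₀ z a (fderiv ℝ (Gam g x₀) z v u b)) := by
  have hg := (((contDiffOn_gm g x₀).contDiffAt
    ((chartAt E x₀).open_target.mem_nhds hz)).differentiableAt (by simp)).hasFDerivAt
  have hg' : ∀ a b, HasFDerivAt (fun z ↦ gm g x₀ z a b) _ z := fun a b ↦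
    (hg.clm_apply (hasFDerivAt_const a _)).clm_apply (hasFDerivAt_const b _)
  have hgv : ∀ a b, fderiv ℝ (gm g x₀) z v a b =
      gm g x₀ z (Gam g x₀ z v a) b + gm g x₀ z a (Gam g x₀ z v b) := fun a b ↦ by
    rw [← fderiv_gm_eq g hz, (hg' a b).fderiv]
    simp
  have hG : ∀ a, HasFDerivAt (fun z ↦ Gam g x₀ z u a) _ z := fun a ↦
    ((hasFDerivAt_Gam g hz).clm_apply (hasFDerivAt_const u _)).clm_apply (hasFDerivAt_const a _)
  have e : (fun z ↦ fderiv ℝ (fun z ↦ gm g x₀ z a b) z u) =ᶠ[𝓝 z] fun z ↦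
      gm g x₀ z (Gam g x₀ z u a) b + gm g x₀ z a (Gam g x₀ z u b) := by
    filter_upwards [(chartAt E x₀).open_target.mem_nhds hz] with z hz using fderiv_gm_eq g hz u a b
  have hd := (((hg.clm_apply (hG a)).clm_apply (hasFDerivAt_const b _)).add
    ((hg.clm_apply (hasFDerivAt_const a _)).clm_apply (hG b))).congr_of_eventuallyEq e
  have hs : ContDiffAt ℝ ∞ (fun z ↦ gm g x₀ z a b) z :=
    ((((contDiffOn_gm g x₀).contDiffAt ((chartAt E x₀).open_target.mem_nhds hz)).clm_apply
      contDiffAt_const).clm_apply contDiffAt_const)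
  have hs' := ((hs.fderiv_right (m := 1) (by exact WithTop.coe_le_coe.2 le_top)).differentiableAt
    (by simp)).hasFDerivAt.clm_apply
    (hasFDerivAt_const u z)
  have := congrArg (fun l ↦ l v) (hs'.unique hd)
  simp [hgv] at this
  rw [this]
  ring

set_option synthInstance.maxHeartbeats 200000 in
/-- `R(u, v)` is skew-adjoint, because the second derivatives of the metric commute. -/
lemma gm_Rm_antisymm (g : RiemMetric E M) {x₀ : M} {z : E} (hz : z ∈ (chartAt E x₀).target)
    (u v a b : E) : gm g x₀ z (Rm g x₀ z u v a) b = - gm g x₀ z a (Rm g x₀ z u v b) := by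
  have hs : ContDiffAt ℝ ∞ (fun z ↦ gm g x₀ z a b) z :=
    ((((contDiffOn_gm g x₀).contDiffAt ((chartAt E x₀).open_target.mem_nhds hz)).clm_apply
      contDiffAt_const).clm_apply contDiffAt_const)
  have h := hs.isSymmSndFDerivAt (by simp; exact WithTop.coe_le_coe.2 le_top) u v
  rw [fderiv_fderiv_gm g hz, fderiv_fderiv_gm g hz] at h
  simp only [Rm, map_add, map_sub, add_apply, sub_apply]
  linarith

/-- The pair symmetry of the curvature tensor, in the form needed for the Jacobi equation: the
operator `u ↦ R(u, v)v` is self-adjoint. -/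
lemma gm_Rm_selfAdjoint (g : RiemMetric E M) {x₀ : M} {z : E} (hz : z ∈ (chartAt E x₀).target)
    (a b v : E) : gm g x₀ z (Rm g x₀ z a v v) b = gm g x₀ z a (Rm g x₀ z b v v) := by
  have hB : ∀ p q r s, gm g x₀ z (Rm g x₀ z p q r) s + gm g x₀ z (Rm g x₀ z q r p) s +
      gm g x₀ z (Rm g x₀ z r p q) s = 0 := by
    intro p q r s
    rw [← add_apply, ← map_add, ← add_apply, ← map_add, Rm_bianchi g hz]
    simp
  have hA : ∀ p q r s, gm g x₀ z (Rm g x₀ z p q r) s = - gm g x₀ z (Rm g x₀ z q p r) s := by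
    intro p q r s
    rw [Rm_antisymm]
    simp
  have hS : ∀ p q r s, gm g x₀ z (Rm g x₀ z p q r) s = - gm g x₀ z (Rm g x₀ z p q s) r := by
    intro p q r s
    rw [gm_Rm_antisymm g hz, gm_symm]
  rw [gm_symm g x₀ z a]
  -- the classical octahedron argument: four instances of the Bianchi identity and the two skew
  -- symmetries
  linarith [hB a v v b, hB v v b a, hB v b a v, hB b a v v, hA a v v b, hA a v b v, hA v b v a,
    hA v b a v, hS a v v b, hS v b v a, hS v v a b, hA v v a b, hS b a v v, hS a b v v, hA a b v v,
    hS v a v b, hS v b a v, hS v a b v, hS b v v a, hA v v b a, hS v v b a, hA v a b v, hS b v a v]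

end LocalCurvature

/-! ### Covariant differentiation along curves -/

section Calculus

variable {E F G : Type*} [NormedAddCommGroup E] [NormedSpace ℝ E] [NormedAddCommGroup F]
  [NormedSpace ℝ F] [NormedAddCommGroup G] [NormedSpace ℝ G]

lemma hasDerivAt_clm_curve {A : E → F →L[ℝ] G} {A' : E →L[ℝ] F →L[ℝ] G} {c : ℝ → E} {c' : E}
    {v : ℝ → F} {v' : F} {t : ℝ} (hA : HasFDerivAt A A' (c t)) (hc : HasDerivAt c c' t)
    (hv : HasDerivAt v v' t) :
    HasDerivAt (fun s ↦ A (c s) (v s)) (A' c' (v t) + A (c t) v') t :=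
  (hA.comp_hasDerivAt t hc).clm_apply hv

lemma hasDerivAt_bilin_curve {B : E → F →L[ℝ] F →L[ℝ] G} {B' : E →L[ℝ] F →L[ℝ] F →L[ℝ] G}
    {c : ℝ → E} {c' : E} {v w : ℝ → F} {v' w' : F} {t : ℝ} (hB : HasFDerivAt B B' (c t))
    (hc : HasDerivAt c c' t) (hv : HasDerivAt v v' t) (hw : HasDerivAt w w' t) :
    HasDerivAt (fun s ↦ B (c s) (v s) (w s))
      (B' c' (v t) (w t) + B (c t) v' (w t) + B (c t) (v t) w') t :=
  (hasDerivAt_clm_curve hB hc hv).clm_apply hw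

end Calculus

section Curves

variable {E : Type*} [NormedAddCommGroup E] [NormedSpace ℝ E]
  {M : Type*} [TopologicalSpace M] [ChartedSpace E M] [IsManifold 𝓘(ℝ, E) ∞ M]

/-- Differentiability at time `t` of a vector field along a curve. -/
def DiffAlong (γ : ℝ → M) (V : ∀ t, TangentSpace 𝓘(ℝ, E) (γ t)) (t : ℝ) : Prop :=
  MDifferentiableAt 𝓘(ℝ, ℝ) (𝓘(ℝ, E).prod 𝓘(ℝ, E))
    (fun t ↦ (⟨γ t, V t⟩ : TangentBundle 𝓘(ℝ, E) M)) t

/-- The components, in the preferred chart at `x₀`, of a vector field along a curve. -/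
def crep (x₀ : M) (γ : ℝ → M) (V : ∀ t, TangentSpace 𝓘(ℝ, E) (γ t)) (t : ℝ) : E :=
  coord x₀ (γ t) (V t)

lemma eventually_curve_mem {γ : ℝ → M} (hγ : ContMDiff 𝓘(ℝ, ℝ) 𝓘(ℝ, E) ∞ γ) {x₀ : M} {t : ℝ}
    (ht : γ t ∈ (chartAt E x₀).source) : ∀ᶠ s in 𝓝 t, γ s ∈ (chartAt E x₀).source :=
  hγ.continuous.continuousAt.preimage_mem_nhds ((chartAt E x₀).open_source.mem_nhds ht)

lemma contDiffAt_chart_curve {γ : ℝ → M} (hγ : ContMDiff 𝓘(ℝ, ℝ) 𝓘(ℝ, E) ∞ γ) {x₀ : M} {t : ℝ}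
    (ht : γ t ∈ (chartAt E x₀).source) : ContDiffAt ℝ ∞ (fun s ↦ chartAt E x₀ (γ s)) t := by
  rw [← contMDiffAt_iff_contDiffAt]
  exact ContMDiffAt.comp t (contMDiffAt_chart ht) (hγ t)

lemma hasDerivAt_chart_curve {γ : ℝ → M} (hγ : ContMDiff 𝓘(ℝ, ℝ) 𝓘(ℝ, E) ∞ γ) {x₀ : M} {t : ℝ}
    (ht : γ t ∈ (chartAt E x₀).source) :
    HasDerivAt (fun s ↦ chartAt E x₀ (γ s)) (deriv (fun s ↦ chartAt E x₀ (γ s)) t) t :=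
  ((contDiffAt_chart_curve hγ ht).differentiableAt (by simp)).hasDerivAt

lemma coord_velocity {γ : ℝ → M} (hγ : ContMDiff 𝓘(ℝ, ℝ) 𝓘(ℝ, E) ∞ γ) {x₀ : M} {t : ℝ}
    (ht : γ t ∈ (chartAt E x₀).source) :
    coord x₀ (γ t) (velocity γ t) = deriv (fun s ↦ chartAt E x₀ (γ s)) t := by
  have htt := mem_chart_source E (γ t)
  have h1 : coord (γ t) (γ t) (velocity γ t) = deriv (fun s ↦ chartAt E (γ t) (γ s)) t := by
    rw [coord_self]
    simp only [velocity, mfderiv, (hγ t).mdifferentiableAt (by simp : (∞ : ℕ∞ω) ≠ 0),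
      modelWithCornersSelf_coe, range_id, fderivWithin_univ]
    rfl
  rw [coord_eq_fderiv_transition htt ht, h1]
  have h2 := ((contDiffAt_transition htt ht).differentiableAt (by simp)).hasFDerivAt.comp_hasDerivAt
    t (hasDerivAt_chart_curve hγ htt)
  refine (h2.congr_of_eventuallyEq ?_).deriv.symm
  filter_upwards [eventually_curve_mem hγ htt] with s hs
  simp [transition, (chartAt E (γ t)).left_inv hs]

/-- Differentiability along a curve may be tested on the components in any chart. -/
lemma diffAlong_iff {γ : ℝ → M} (hγ : ContMDiff 𝓘(ℝ, ℝ) 𝓘(ℝ, E) ∞ γ) {x₀ : M} {t : ℝ}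
    (ht : γ t ∈ (chartAt E x₀).source) (V : ∀ t, TangentSpace 𝓘(ℝ, E) (γ t)) :
    DiffAlong γ V t ↔ DifferentiableAt ℝ (crep x₀ γ V) t := by
  have h := (trivializationAt E (TangentSpace 𝓘(ℝ, E)) x₀).mdifferentiableAt_totalSpace_iff
    (IB := 𝓘(ℝ, E)) (IM := 𝓘(ℝ, ℝ)) (fun t ↦ (⟨γ t, V t⟩ : TangentBundle 𝓘(ℝ, E) M))
    (x₀ := t) (by rw [Trivialization.mem_source]; simpa using ht)
  have hγ' : MDifferentiableAt 𝓘(ℝ, ℝ) 𝓘(ℝ, E) γ t := (hγ t).mdifferentiableAt (by simp)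
  rw [DiffAlong, h, ← mdifferentiableAt_iff_differentiableAt]
  have e : crep x₀ γ V =ᶠ[𝓝 t]
      fun s ↦ (trivializationAt E (TangentSpace 𝓘(ℝ, E)) x₀ ⟨γ s, V s⟩).2 := by
    filter_upwards [eventually_curve_mem hγ ht] with s hs
    simp [crep, coord, Trivialization.continuousLinearMapAt_apply,
      Trivialization.linearMapAt_apply, hs]
  exact ⟨fun h ↦ h.2.congr_of_eventuallyEq e, fun h ↦ ⟨hγ', h.congr_of_eventuallyEq e.symm⟩⟩

variable [FiniteDimensional ℝ E]

/-- The covariant derivative along a curve, computed in an arbitrary chart. -/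
lemma coord_covDerivAlong (g : RiemMetric E M) {γ : ℝ → M}
    (hγ : ContMDiff 𝓘(ℝ, ℝ) 𝓘(ℝ, E) ∞ γ) {x₀ : M} {t : ℝ} (ht : γ t ∈ (chartAt E x₀).source)
    {V : ∀ t, TangentSpace 𝓘(ℝ, E) (γ t)} (hV : DifferentiableAt ℝ (crep x₀ γ V) t) :
    coord x₀ (γ t) (covDerivAlong g γ V t) = deriv (crep x₀ γ V) t +
      Gam g x₀ (chartAt E x₀ (γ t)) (deriv (fun s ↦ chartAt E x₀ (γ s)) t) (crep x₀ γ V t) := by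
  have htt := mem_chart_source E (γ t)
  have e : (fun s ↦ coord (γ t) (γ s) (V s)) =ᶠ[𝓝 t] fun s ↦
      fderiv ℝ (transition (E := E) x₀ (γ t)) (chartAt E x₀ (γ s)) (crep x₀ γ V s) := by
    filter_upwards [eventually_curve_mem hγ htt, eventually_curve_mem hγ ht] with s hs hs'
    exact coord_eq_fderiv_transition hs' hs (V s)
  have hd := (hasDerivAt_clm_curve (c := fun s ↦ chartAt E x₀ (γ s))
    (hasFDerivAt_fderiv_transition ht htt) (hasDerivAt_chart_curve hγ ht)
    hV.hasDerivAt).congr_of_eventuallyEq e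
  rw [covDerivAlong, hd.deriv, ← chr_eq_Gam g ht, chr]
  have h1 : ∀ v : E, coord x₀ (γ t) (coordSymm (γ t) (γ t)
      (fderiv ℝ (transition x₀ (γ t)) (chartAt E x₀ (γ t)) v)) = v := by
    intro v
    rw [← coord_coordSymm_eq ht htt, coordSymm_coord_self, coord_coordSymm ht]
  rw [map_add, map_add, map_add, map_add, h1, ← coord_velocity hγ ht, crep, coordSymm_coord ht,
    coordSymm_coord ht, map_add, map_add]
  abel

lemma DiffAlong.add {γ : ℝ → M} (hγ : ContMDiff 𝓘(ℝ, ℝ) 𝓘(ℝ, E) ∞ γ)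
    {V W : ∀ t, TangentSpace 𝓘(ℝ, E) (γ t)} {t : ℝ} (hV : DiffAlong γ V t)
    (hW : DiffAlong γ W t) : DiffAlong γ (fun s ↦ V s + W s) t := by
  have htt := mem_chart_source E (γ t)
  rw [diffAlong_iff hγ htt] at *
  refine (hV.add hW).congr_of_eventuallyEq (Eventually.of_forall fun s ↦ ?_)
  simp [crep]

lemma DiffAlong.const_smul {γ : ℝ → M} (hγ : ContMDiff 𝓘(ℝ, ℝ) 𝓘(ℝ, E) ∞ γ) (c : ℝ)
    {V : ∀ t, TangentSpace 𝓘(ℝ, E) (γ t)} {t : ℝ} (hV : DiffAlong γ V t) :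
    DiffAlong γ (fun s ↦ c • V s) t := by
  have htt := mem_chart_source E (γ t)
  rw [diffAlong_iff hγ htt] at *
  refine (hV.const_smul c).congr_of_eventuallyEq (Eventually.of_forall fun s ↦ ?_)
  simp [crep]

lemma covDerivAlong_add (g : RiemMetric E M) {γ : ℝ → M} (hγ : ContMDiff 𝓘(ℝ, ℝ) 𝓘(ℝ, E) ∞ γ)
    {V W : ∀ t, TangentSpace 𝓘(ℝ, E) (γ t)} {t : ℝ} (hV : DiffAlong γ V t)
    (hW : DiffAlong γ W t) : covDerivAlong g γ (fun s ↦ V s + W s) t =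
      covDerivAlong g γ V t + covDerivAlong g γ W t := by
  have htt := mem_chart_source E (γ t)
  rw [diffAlong_iff hγ htt] at hV hW
  have h := deriv_add hV hW
  have e : (fun s ↦ coord (γ t) (γ s) (V s + W s)) = crep (γ t) γ V + crep (γ t) γ W := by
    ext s
    simp [crep]
  unfold covDerivAlong
  beta_reduce
  rw [e, h, map_add (coord (γ t) (γ t)), christoffel_add, add_apply, ← map_add]
  congr 1
  unfold crep
  abel

lemma covDerivAlong_const_smul (g : RiemMetric E M) (γ : ℝ → M) (c : ℝ)
    (V : ∀ t, TangentSpace 𝓘(ℝ, E) (γ t)) (t : ℝ) :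
    covDerivAlong g γ (fun s ↦ c • V s) t = c • covDerivAlong g γ V t := by
  have e : (fun s ↦ coord (γ t) (γ s) (c • V s)) = fun s ↦ c • coord (γ t) (γ s) (V s) := by
    ext s
    simp
  unfold covDerivAlong
  rw [e, deriv_fun_const_smul_field, map_smul, christoffel_smul, smul_apply, ← smul_add, map_smul]

lemma covDerivAlong_zero (g : RiemMetric E M) (γ : ℝ → M) (t : ℝ) :
    covDerivAlong g γ (fun _ ↦ 0) t = 0 := by
  have := covDerivAlong_const_smul g γ 0 (fun _ ↦ 0) t
  simpa using this

/-- The chain rule for `t ↦ a t + b`. Only the velocity of the reparametrised curve enters the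
definition of the covariant derivative, so no regularity of `V` is needed: `deriv` obeys the rule
for `t ↦ a t + b` even where it takes a default value. -/
lemma covDerivAlong_comp (g : RiemMetric E M) {γ : ℝ → M}
    (V : ∀ t, TangentSpace 𝓘(ℝ, E) (γ t)) (a b t : ℝ)
    (hv : velocity (E := E) (fun s ↦ γ (a * s + b)) t = a • velocity γ (a * t + b)) :
    covDerivAlong g (fun s ↦ γ (a * s + b)) (fun s ↦ V (a * s + b)) t =
      a • covDerivAlong g γ V (a * t + b) := by
  have h := deriv_comp_mul_left a (fun s ↦ coord (γ (a * t + b)) (γ (s + b)) (V (s + b))) t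
  have h' := deriv_comp_add_const (fun s ↦ coord (γ (a * t + b)) (γ s) (V s)) b (a * t)
  simp only [covDerivAlong, h, h', hv, map_smul, ← smul_add]

lemma contMDiff_comp_affine {γ : ℝ → M} (hγ : ContMDiff 𝓘(ℝ, ℝ) 𝓘(ℝ, E) ∞ γ) (a b : ℝ) :
    ContMDiff 𝓘(ℝ, ℝ) 𝓘(ℝ, E) ∞ (fun s ↦ γ (a * s + b)) := by
  have : ContMDiff 𝓘(ℝ, ℝ) 𝓘(ℝ, ℝ) ∞ (fun s : ℝ ↦ a * s + b) := by
    rw [contMDiff_iff_contDiff]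
    fun_prop
  exact hγ.comp this

lemma velocity_comp_affine {γ : ℝ → M} (hγ : ContMDiff 𝓘(ℝ, ℝ) 𝓘(ℝ, E) ∞ γ) (a b t : ℝ) :
    velocity (E := E) (fun s ↦ γ (a * s + b)) t = a • velocity γ (a * t + b) := by
  have htt := mem_chart_source E (γ (a * t + b))
  have h1 := coord_velocity (contMDiff_comp_affine hγ a b) (t := t) htt
  have h2 := coord_velocity hγ (t := a * t + b) htt
  rw [coord_self] at h1 h2
  rw [h1, h2, deriv_comp_mul_left a (fun s ↦ chartAt E (γ (a * t + b)) (γ (s + b))) t,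
    deriv_comp_add_const (fun s ↦ chartAt E (γ (a * t + b)) (γ s))]
  rfl

lemma DiffAlong.comp_affine {γ : ℝ → M} {V : ∀ t, TangentSpace 𝓘(ℝ, E) (γ t)} (a b : ℝ) {t : ℝ}
    (h : DiffAlong γ V (a * t + b)) :
    DiffAlong (fun s ↦ γ (a * s + b)) (fun s ↦ V (a * s + b)) t := by
  have : MDifferentiableAt 𝓘(ℝ, ℝ) 𝓘(ℝ, ℝ) (fun s : ℝ ↦ a * s + b) t := by
    rw [mdifferentiableAt_iff_differentiableAt]
    fun_prop
  exact MDifferentiableAt.comp (f := fun s : ℝ ↦ a * s + b) t h this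

set_option synthInstance.maxHeartbeats 400000 in
/-- The product rule for the inner product of two vector fields along a curve. -/
lemma hasDerivAt_inner (g : RiemMetric E M) {γ : ℝ → M} (hγ : ContMDiff 𝓘(ℝ, ℝ) 𝓘(ℝ, E) ∞ γ)
    {V W : ∀ t, TangentSpace 𝓘(ℝ, E) (γ t)} {t : ℝ} (hV : DiffAlong γ V t)
    (hW : DiffAlong γ W t) : HasDerivAt (fun s ↦ g.inner (γ s) (V s) (W s))
      (g.inner (γ t) (covDerivAlong g γ V t) (W t) +
        g.inner (γ t) (V t) (covDerivAlong g γ W t)) t := by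
  have htt := mem_chart_source E (γ t)
  rw [diffAlong_iff hγ htt] at hV hW
  have hz := (chartAt E (γ t)).map_source htt
  have hg := (((contDiffOn_gm g (γ t)).contDiffAt
    ((chartAt E (γ t)).open_target.mem_nhds hz)).differentiableAt (by simp)).hasFDerivAt
  have hgv : ∀ u a b, fderiv ℝ (gm g (γ t)) (chartAt E (γ t) (γ t)) u a b =
      gm g (γ t) (chartAt E (γ t) (γ t)) (Gam g (γ t) (chartAt E (γ t) (γ t)) u a) b +
      gm g (γ t) (chartAt E (γ t) (γ t)) a (Gam g (γ t) (chartAt E (γ t) (γ t)) u b) :=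
      fun u a b ↦ by
    rw [← fderiv_gm_eq g hz, ((hg.clm_apply (hasFDerivAt_const a _)).clm_apply
      (hasFDerivAt_const b _)).fderiv]
    simp
  have hd := hasDerivAt_bilin_curve hg (hasDerivAt_chart_curve hγ htt) hV.hasDerivAt hW.hasDerivAt
  have hd' := hd.congr_of_eventuallyEq (f₁ := fun s ↦ g.inner (γ s) (V s) (W s)) (by
    filter_upwards [eventually_curve_mem hγ htt] with s hs using inner_eq_gm g hs _ _)
  refine hd'.congr_deriv ?_
  rw [inner_eq_gm g htt, inner_eq_gm g htt, coord_covDerivAlong g hγ htt hV,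
    coord_covDerivAlong g hγ htt hW, map_add, map_add, add_apply, hgv]
  unfold crep
  ring

end Curves

/-! ### Evolution problems on the real line -/

section Gluing

variable {X : Type*} {P : ℝ → (ℝ → X) → Prop}

/-- A local evolution problem on the real line: `P t f` expresses that `f` is a solution at time
`t`. Near each time, solutions exist for all initial values and all nearby initial times, on a
common interval, and are unique. -/
structure IsLocalEvolution (P : ℝ → (ℝ → X) → Prop) : Prop where
  congr : ∀ t f f', f =ᶠ[𝓝 t] f' → P t f → P t f'
  exists_local : ∀ t₀, ∃ ε > 0, ∀ t₁ ∈ Ioo (t₀ - ε) (t₀ + ε), ∀ x, ∃ f : ℝ → X, f t₁ = x ∧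
    ∀ t ∈ Ioo (t₀ - ε) (t₀ + ε), P t f
  unique_local : ∀ t₀, ∃ ε > 0, ∀ a b, Ioo a b ⊆ Ioo (t₀ - ε) (t₀ + ε) → ∀ t₁ ∈ Ioo a b,
    ∀ f f', (∀ t ∈ Ioo a b, P t f) → (∀ t ∈ Ioo a b, P t f') → f t₁ = f' t₁ → EqOn f f' (Ioo a b)

/-- Uniqueness on an interval, by connectedness: whether two solutions agree is locally constant. -/
lemma IsLocalEvolution.eqOn (hP : IsLocalEvolution P) {a b t₁ : ℝ} (ht₁ : t₁ ∈ Ioo a b)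
    {f f' : ℝ → X} (hf : ∀ t ∈ Ioo a b, P t f) (hf' : ∀ t ∈ Ioo a b, P t f')
    (h : f t₁ = f' t₁) : EqOn f f' (Ioo a b) := by
  intro t₂ ht₂
  refine (isPreconnected_Ioo.induction₂ (fun s t ↦ (f s = f' s ↔ f t = f' t)) ?_
    (fun _ _ _ _ _ _ h h' ↦ h.trans h') (fun _ _ _ _ h ↦ h.symm) ht₁ ht₂).1 h
  intro t₀ ht₀
  obtain ⟨ε, hε, hu⟩ := hP.unique_local t₀
  have hJ : Ioo (max a (t₀ - ε)) (min b (t₀ + ε)) ∈ 𝓝 t₀ :=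
    Ioo_mem_nhds (max_lt ht₀.1 (by linarith)) (lt_min ht₀.2 (by linarith))
  filter_upwards [mem_nhdsWithin_of_mem_nhds hJ] with t ht
  have key : ∀ s ∈ Ioo (max a (t₀ - ε)) (min b (t₀ + ε)),
      ∀ s' ∈ Ioo (max a (t₀ - ε)) (min b (t₀ + ε)), f s = f' s → f s' = f' s' :=
    fun s hs s' hs' he ↦ hu _ _ (Ioo_subset_Ioo (le_max_right _ _) (min_le_right _ _)) s hs f f'
      (fun t ht ↦ hf t ⟨(le_max_left _ _).trans_lt ht.1, ht.2.trans_le (min_le_left _ _)⟩)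
      (fun t ht ↦ hf' t ⟨(le_max_left _ _).trans_lt ht.1, ht.2.trans_le (min_le_left _ _)⟩) he hs'
  exact ⟨key _ (mem_of_mem_nhds hJ) _ ht, key _ ht _ (mem_of_mem_nhds hJ)⟩

lemma IsLocalEvolution.unique (hP : IsLocalEvolution P) {t₁ : ℝ} {f f' : ℝ → X} (hf : ∀ t, P t f)
    (hf' : ∀ t, P t f') (h : f t₁ = f' t₁) : f = f' := by
  ext t
  exact hP.eqOn (a := min t t₁ - 1) (b := max t t₁ + 1) (t₁ := t₁)
    ⟨by linarith [min_le_right t t₁], by linarith [le_max_right t t₁]⟩ (fun t _ ↦ hf t)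
    (fun t _ ↦ hf' t) h ⟨by linarith [min_le_left t t₁], by linarith [le_max_left t t₁]⟩

/-- Two solutions that agree near `s` combine to one that is the first before `s` and the second
after it. -/
lemma IsLocalEvolution.glue (hP : IsLocalEvolution P) {a s d : ℝ} {f h : ℝ → X}
    (hf : ∀ t ∈ Ioc a s, P t f) (hh : ∀ t ∈ Ico s d, P t h) (e : f =ᶠ[𝓝 s] h) :
    ∃ k : ℝ → X, (∀ t ∈ Ioo a d, P t k) ∧ (∀ t < s, k t = f t) ∧ ∀ t, s ≤ t → k t = h t := by
  refine ⟨fun t ↦ if t < s then f t else h t, fun t ht ↦ ?_, fun t ht ↦ by simp [ht],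
    fun t ht ↦ by simp [not_lt.2 ht]⟩
  rcases lt_trichotomy t s with hts | rfl | hts
  · refine hP.congr t f _ ?_ (hf t ⟨ht.1, hts.le⟩)
    filter_upwards [Iio_mem_nhds hts] with r hr
    rw [if_pos (mem_Iio.1 hr)]
  · refine hP.congr t h _ ?_ (hh t ⟨le_rfl, ht.2⟩)
    filter_upwards [e] with r hr
    split_ifs
    exacts [hr.symm, rfl]
  · refine hP.congr t h _ ?_ (hh t ⟨hts.le, ht.2⟩)
    filter_upwards [Ioi_mem_nhds hts] with r hr
    rw [if_neg (not_lt.2 (le_of_lt hr))]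

/-- Solutions exist on arbitrarily large intervals around the initial time: near the supremum of the
possible half-lengths, a solution can be continued beyond both ends by `IsLocalEvolution.glue`. -/
lemma IsLocalEvolution.exists_Ioo (hP : IsLocalEvolution P) (t₁ : ℝ) (x : X) (T : ℝ) :
    ∃ f : ℝ → X, f t₁ = x ∧ ∀ t ∈ Ioo (t₁ - T) (t₁ + T), P t f := by
  by_contra hT
  let S : Set ℝ := {T | ∃ f : ℝ → X, f t₁ = x ∧ ∀ t ∈ Ioo (t₁ - T) (t₁ + T), P t f}
  have hbdd : BddAbove S := by
    refine ⟨T, fun T' ⟨f, hf, hf'⟩ ↦ ?_⟩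
    by_contra hlt
    rw [not_le] at hlt
    exact hT ⟨f, hf, fun t ht ↦ hf' t ⟨by linarith [ht.1], by linarith [ht.2]⟩⟩
  obtain ⟨ε₀, hε₀, h₀⟩ := hP.exists_local t₁
  have hS₀ : ε₀ ∈ S := h₀ t₁ ⟨by linarith, by linarith⟩ x
  set m := sSup S with hm
  have hm₀ : 0 < m := hε₀.trans_le (le_csSup hbdd hS₀)
  obtain ⟨ε₁, hε₁, h₁⟩ := hP.exists_local (t₁ + m)
  obtain ⟨ε₂, hε₂, h₂⟩ := hP.exists_local (t₁ - m)
  set δ := min m (min ε₁ ε₂) with hδ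
  have hδ₀ : 0 < δ := lt_min hm₀ (lt_min hε₁ hε₂)
  have hδm : δ ≤ m := min_le_left _ _
  have hδ₁ : δ ≤ ε₁ := (min_le_right _ _).trans (min_le_left _ _)
  have hδ₂ : δ ≤ ε₂ := (min_le_right _ _).trans (min_le_right _ _)
  obtain ⟨T', ⟨f, hfx, hf⟩, hT'⟩ := exists_lt_of_lt_csSup ⟨ε₀, hS₀⟩
    (show m - δ / 2 < sSup S by linarith)
  have hT'm : T' ≤ m := le_csSup hbdd ⟨f, hfx, hf⟩
  set r := T' - δ / 4 with hr
  obtain ⟨k₁, hk₁, hk₁'⟩ := h₁ (t₁ + r) ⟨by linarith, by linarith⟩ (f (t₁ + r))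
  obtain ⟨k₂, hk₂, hk₂'⟩ := h₂ (t₁ - r) ⟨by linarith, by linarith⟩ (f (t₁ - r))
  have e₁ : f =ᶠ[𝓝 (t₁ + r)] k₁ := by
    have hI : t₁ + r ∈ Ioo (t₁ + T' - δ / 2) (t₁ + T') := ⟨by linarith, by linarith⟩
    filter_upwards [Ioo_mem_nhds hI.1 hI.2] with t ht
    exact hP.eqOn hI (fun t ht ↦ hf t ⟨by linarith [ht.1], ht.2⟩)
      (fun t ht ↦ hk₁' t ⟨by linarith [ht.1], by linarith [ht.2]⟩) hk₁.symm ht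
  have e₂ : k₂ =ᶠ[𝓝 (t₁ - r)] f := by
    have hI : t₁ - r ∈ Ioo (t₁ - T') (t₁ - T' + δ / 2) := ⟨by linarith, by linarith⟩
    filter_upwards [Ioo_mem_nhds hI.1 hI.2] with t ht
    exact hP.eqOn hI (fun t ht ↦ hk₂' t ⟨by linarith [ht.1], by linarith [ht.2]⟩)
      (fun t ht ↦ hf t ⟨ht.1, by linarith [ht.2]⟩) hk₂ ht
  obtain ⟨k, hk, hkf, -⟩ := hP.glue (a := t₁ - T') (d := t₁ + m + δ) (s := t₁ + r)
    (fun t ht ↦ hf t ⟨ht.1, by linarith [ht.2]⟩)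
    (fun t ht ↦ hk₁' t ⟨by linarith [ht.1], by linarith [ht.2]⟩) e₁
  have e₂' : k₂ =ᶠ[𝓝 (t₁ - r)] k := by
    filter_upwards [e₂, Iio_mem_nhds (show t₁ - r < t₁ + r by linarith)] with t ht ht'
    rw [ht, hkf t ht']
  obtain ⟨k', hk', -, hk'f⟩ := hP.glue (a := t₁ - m - δ) (d := t₁ + m + δ) (s := t₁ - r)
    (fun t ht ↦ hk₂' t ⟨by linarith [ht.1], by linarith [ht.2]⟩)
    (fun t ht ↦ hk t ⟨by linarith [ht.1], by linarith [ht.2]⟩) e₂'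
  have hmem : m + δ ∈ S := by
    refine ⟨k', ?_, fun t ht ↦ hk' t ⟨by linarith [ht.1], by linarith [ht.2]⟩⟩
    rw [hk'f t₁ (by linarith), hkf t₁ (by linarith), hfx]
  linarith [le_csSup hbdd hmem]

/-- Solutions of a local evolution problem extend to the whole line. -/
lemma IsLocalEvolution.exists_global (hP : IsLocalEvolution P) (t₁ : ℝ) (x : X) :
    ∃ f : ℝ → X, f t₁ = x ∧ ∀ t, P t f := by
  choose f hf hf' using fun T ↦ hP.exists_Ioo t₁ x T
  have key : ∀ T T' t, |t - t₁| < T → |t - t₁| < T' → f T t = f T' t := by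
    intro T T' t hT hT'
    wlog h : T ≤ T' generalizing T T'
    · exact (this T' T hT' hT (le_of_not_ge h)).symm
    have h0 : 0 < T := (abs_nonneg _).trans_lt hT
    refine hP.eqOn (t₁ := t₁) ⟨by linarith, by linarith⟩ (hf' T)
      (fun t ht ↦ hf' T' t ⟨by linarith [ht.1], by linarith [ht.2]⟩) ((hf T).trans (hf T').symm) ?_
    rw [abs_lt] at hT
    exact ⟨by linarith, by linarith⟩
  refine ⟨fun t ↦ f (|t - t₁| + 1) t, hf _, fun t ↦ ?_⟩
  refine hP.congr t (f (|t - t₁| + 2)) _ ?_ (hf' _ t ?_)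
  · have : ContinuousAt (fun s ↦ |s - t₁|) t := by fun_prop
    filter_upwards [this.eventually_lt continuousAt_const
      (show |t - t₁| < |t - t₁| + 1 by linarith)] with s hs
    exact key _ _ s (by linarith) (by linarith)
  · have := abs_lt.1 (show |t - t₁| < |t - t₁| + 2 by linarith)
    exact ⟨by linarith, by linarith⟩

end Gluing

section LinearODE

variable {F : Type*} [NormedAddCommGroup F] [NormedSpace ℝ F] [CompleteSpace F]

/-- Local existence and uniqueness for linear ordinary differential equations, with a uniform
time of existence. -/
lemma linearODE_local {A : ℝ → F →L[ℝ] F} {t₀ : ℝ} (hA : ∀ᶠ t in 𝓝 t₀, ContinuousAt A t) :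
    ∃ ε₀ > 0, ∀ ε, 0 < ε → ε ≤ ε₀ → (∀ t₁ ∈ Ioo (t₀ - ε) (t₀ + ε), ∀ x, ∃ f : ℝ → F, f t₁ = x ∧
      ∀ t ∈ Ioo (t₀ - ε) (t₀ + ε), HasDerivAt f (A t (f t)) t) ∧
    ∀ a b, Ioo a b ⊆ Ioo (t₀ - ε) (t₀ + ε) → ∀ t₁ ∈ Ioo a b, ∀ f f' : ℝ → F,
      (∀ t ∈ Ioo a b, HasDerivAt f (A t (f t)) t) → (∀ t ∈ Ioo a b, HasDerivAt f' (A t (f' t)) t) →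
      f t₁ = f' t₁ → EqOn f f' (Ioo a b) := by
  obtain ⟨δ, hδ, hAδ⟩ := Metric.eventually_nhds_iff.1 hA
  have hcont : ContinuousOn A (Icc (t₀ - δ / 2) (t₀ + δ / 2)) := fun t ht ↦ by
    refine (hAδ ?_).continuousWithinAt
    rw [Real.dist_eq, abs_lt]
    exact ⟨by linarith [ht.1], by linarith [ht.2]⟩
  obtain ⟨C, hC⟩ := isCompact_Icc.exists_bound_of_continuousOn hcont
  set K : NNReal := C.toNNReal + 1 with hK
  have hK1 : (1 : ℝ) ≤ K := by simp [hK]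
  have hAK : ∀ t ∈ Icc (t₀ - δ / 2) (t₀ + δ / 2), ‖A t‖ ≤ K := fun t ht ↦ by
    have := Real.le_coe_toNNReal C
    have := hC t ht
    simp only [hK, NNReal.coe_add, NNReal.coe_one]
    linarith
  have hLip : ∀ t ∈ Icc (t₀ - δ / 2) (t₀ + δ / 2), LipschitzWith K (A t) := fun t ht ↦
    (A t).lipschitz.weaken (by exact_mod_cast hAK t ht)
  refine ⟨min (δ / 2) (1 / (4 * K)), by positivity, fun ε hε hle ↦ ?_⟩
  have hε1 : ε ≤ δ / 2 := hle.trans (min_le_left _ _)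
  have hε2 : K * (2 * ε) ≤ 1 / 2 := by
    have h := hle.trans (min_le_right _ _)
    rw [le_div_iff₀ (by positivity)] at h
    linarith
  have hsub : Icc (t₀ - ε) (t₀ + ε) ⊆ Icc (t₀ - δ / 2) (t₀ + δ / 2) :=
    Icc_subset_Icc (by linarith) (by linarith)
  constructor
  · intro t₁ ht₁ x
    have hpl : IsPicardLindelof (fun t y ↦ A t y) (tmin := t₀ - ε) (tmax := t₀ + ε)
        ⟨t₁, Ioo_subset_Icc_self ht₁⟩ x (‖x‖₊ + 1) 0 (K * (2 * ‖x‖₊ + 1)) K :=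
      { lipschitzOnWith := fun t ht ↦ (hLip t (hsub ht)).lipschitzOnWith
        continuousOn := fun y _ ↦ (hcont.mono hsub).clm_apply continuousOn_const
        norm_le := fun t ht y hy ↦ by
          rw [mem_closedBall_iff_norm] at hy
          have h1 : ‖y‖ ≤ 2 * ‖x‖ + 1 := by
            have := norm_le_norm_add_norm_sub' y x
            simp only [NNReal.coe_add, coe_nnnorm, NNReal.coe_one] at hy
            linarith
          refine ((A t).le_opNorm y).trans ?_
          push_cast
          exact mul_le_mul (hAK t (hsub ht)) h1 (norm_nonneg _) (NNReal.coe_nonneg _)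
        mul_max_le := by
          push_cast
          have h1 : max (t₀ + ε - t₁) (t₁ - (t₀ - ε)) ≤ 2 * ε :=
            max_le (by linarith [ht₁.1]) (by linarith [ht₁.2])
          calc (K : ℝ) * (2 * ‖x‖ + 1) * max (t₀ + ε - t₁) (t₁ - (t₀ - ε))
              ≤ K * (2 * ‖x‖ + 1) * (2 * ε) := by gcongr
            _ = K * (2 * ε) * (2 * ‖x‖ + 1) := by ring
            _ ≤ 1 / 2 * (2 * ‖x‖ + 1) := by gcongr
            _ ≤ ‖x‖ + 1 - 0 := by linarith }
    obtain ⟨f, hf, hf'⟩ := hpl.exists_eq_forall_mem_Icc_hasDerivWithinAt₀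
    exact ⟨f, hf, fun t ht ↦ (hf' t (Ioo_subset_Icc_self ht)).hasDerivAt (Icc_mem_nhds ht.1 ht.2)⟩
  · intro a b hab t₁ ht₁ f f' hf hf' h
    exact ODE_solution_unique_of_mem_Ioo (v := fun t y ↦ A t y) (s := fun _ ↦ univ) (K := K)
      (fun t ht ↦ (hLip t (hsub (Ioo_subset_Icc_self (hab ht)))).lipschitzOnWith) ht₁
      (fun t ht ↦ ⟨hf t ht, trivial⟩) (fun t ht ↦ ⟨hf' t ht, trivial⟩) h

end LinearODE

/-! ### The Jacobi equation as a first order system -/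

section JacobiEvolution

variable {E : Type*} [NormedAddCommGroup E] [NormedSpace ℝ E]
  {M : Type*} [TopologicalSpace M] [ChartedSpace E M] [IsManifold 𝓘(ℝ, E) ∞ M]
  [FiniteDimensional ℝ E]

lemma coord_injective {x₀ y : M} (hy : y ∈ (chartAt E x₀).source)
    {a b : TangentSpace 𝓘(ℝ, E) y} (h : coord x₀ y a = coord x₀ y b) : a = b := by
  rw [← coordSymm_coord hy a, h, coordSymm_coord hy]

set_option synthInstance.maxHeartbeats 200000 in
/-- The operator `w ↦ R(w, v)v` in the preferred chart at `x₀`. -/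
def jacOp (g : RiemMetric E M) (x₀ : M) (z v : E) : E →L[ℝ] E :=
  ((fderiv ℝ (Gam g x₀) z).flip v).flip v - (fderiv ℝ (Gam g x₀) z v).flip v +
    (Gam g x₀ z).flip (Gam g x₀ z v v) - (Gam g x₀ z v) ∘L ((Gam g x₀ z).flip v)

lemma jacOp_apply (g : RiemMetric E M) (x₀ : M) (z v w : E) :
    jacOp g x₀ z v w = Rm g x₀ z w v v := rfl

/-- The Jacobi equation as a linear first order system in the preferred chart at `x₀`, for the
components of a field and of its covariant derivative. -/
def jacCoeff (g : RiemMetric E M) (x₀ : M) (γ : ℝ → M) (t : ℝ) : E × E →L[ℝ] E × E :=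
  letI c' := deriv (fun s ↦ chartAt E x₀ (γ s)) t
  (ContinuousLinearMap.snd ℝ E E -
      (Gam g x₀ (chartAt E x₀ (γ t)) c') ∘L ContinuousLinearMap.fst ℝ E E).prod
    (-(jacOp g x₀ (chartAt E x₀ (γ t)) c') ∘L ContinuousLinearMap.fst ℝ E E -
      (Gam g x₀ (chartAt E x₀ (γ t)) c') ∘L ContinuousLinearMap.snd ℝ E E)

lemma jacCoeff_apply (g : RiemMetric E M) (x₀ : M) (γ : ℝ → M) (t : ℝ) (p : E × E) :
    jacCoeff g x₀ γ t p =
      (p.2 - Gam g x₀ (chartAt E x₀ (γ t)) (deriv (fun s ↦ chartAt E x₀ (γ s)) t) p.1,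
      - Rm g x₀ (chartAt E x₀ (γ t)) p.1 (deriv (fun s ↦ chartAt E x₀ (γ s)) t)
        (deriv (fun s ↦ chartAt E x₀ (γ s)) t) -
      Gam g x₀ (chartAt E x₀ (γ t)) (deriv (fun s ↦ chartAt E x₀ (γ s)) t) p.2) := rfl

/-- The first component of a pair of vector fields along a curve `γ`. A pair is encoded by a
function `p : ℝ → E × E`, which makes sense because every tangent space `TangentSpace 𝓘(ℝ, E) (γ t)`
is by definition a copy of `E`; no chart is involved, and `p` itself need not be continuous. -/
def fstField (γ : ℝ → M) (p : ℝ → E × E) (t : ℝ) : TangentSpace 𝓘(ℝ, E) (γ t) := (p t).1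

/-- The second component of a pair of vector fields along a curve, encoded as in `fstField`. -/
def sndField (γ : ℝ → M) (p : ℝ → E × E) (t : ℝ) : TangentSpace 𝓘(ℝ, E) (γ t) := (p t).2

/-- The pair `p = (Y, Z)` of vector fields along `γ` satisfies `Y' = Z` and
`Z' = - R(Y, γ')γ'` at time `t`. -/
def IsJacobiPairAt (g : RiemMetric E M) (γ : ℝ → M) (t : ℝ) (p : ℝ → E × E) : Prop :=
  DiffAlong γ (fstField γ p) t ∧ DiffAlong γ (sndField γ p) t ∧
    covDerivAlong g γ (fstField γ p) t = sndField γ p t ∧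
    covDerivAlong g γ (sndField γ p) t =
      - curvature g (γ t) (fstField γ p t) (velocity γ t) (velocity γ t)

/-- The components, in the preferred chart at `x₀`, of a pair of vector fields along a curve. -/
def pairRep (x₀ : M) (γ : ℝ → M) (p : ℝ → E × E) (t : ℝ) : E × E :=
  (crep x₀ γ (fstField γ p) t, crep x₀ γ (sndField γ p) t)

lemma isJacobiPairAt_iff (g : RiemMetric E M) {γ : ℝ → M} (hγ : ContMDiff 𝓘(ℝ, ℝ) 𝓘(ℝ, E) ∞ γ)
    {x₀ : M} {t : ℝ} (ht : γ t ∈ (chartAt E x₀).source) (p : ℝ → E × E) :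
    IsJacobiPairAt g γ t p ↔
      HasDerivAt (pairRep x₀ γ p) (jacCoeff g x₀ γ t (pairRep x₀ γ p t)) t := by
  rw [IsJacobiPairAt, diffAlong_iff hγ ht, diffAlong_iff hγ ht, jacCoeff_apply]
  constructor
  · rintro ⟨h1, h2, h3, h4⟩
    refine (h1.hasDerivAt.prodMk h2.hasDerivAt).congr_deriv ?_
    have h3' := congrArg (coord x₀ (γ t)) h3
    have h4' := congrArg (coord x₀ (γ t)) h4
    rw [coord_covDerivAlong g hγ ht h1] at h3'
    rw [coord_covDerivAlong g hγ ht h2, map_neg, coord_curvature g ht, coord_velocity hγ ht] at h4'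
    exact Prod.ext (eq_sub_of_add_eq h3') (eq_sub_of_add_eq h4')
  · intro h
    have h1 := (ContinuousLinearMap.fst ℝ E E).hasFDerivAt.comp_hasDerivAt t h
    have h2 := (ContinuousLinearMap.snd ℝ E E).hasFDerivAt.comp_hasDerivAt t h
    have h1' : HasDerivAt (crep x₀ γ (fstField γ p)) _ t := h1
    have h2' : HasDerivAt (crep x₀ γ (sndField γ p)) _ t := h2
    refine ⟨h1'.differentiableAt, h2'.differentiableAt, coord_injective ht ?_,
      coord_injective ht ?_⟩
    · rw [coord_covDerivAlong g hγ ht h1'.differentiableAt, h1'.deriv]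
      exact sub_add_cancel _ _
    · rw [coord_covDerivAlong g hγ ht h2'.differentiableAt, h2'.deriv, map_neg,
        coord_curvature g ht, coord_velocity hγ ht]
      exact sub_add_cancel _ _

set_option synthInstance.maxHeartbeats 200000 in
lemma continuousAt_jacCoeff (g : RiemMetric E M) {γ : ℝ → M}
    (hγ : ContMDiff 𝓘(ℝ, ℝ) 𝓘(ℝ, E) ∞ γ) {x₀ : M} {t : ℝ} (ht : γ t ∈ (chartAt E x₀).source) :
    ContinuousAt (jacCoeff g x₀ γ) t := by
  have hz := (chartAt E x₀).open_target.mem_nhds ((chartAt E x₀).map_source ht)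
  have hc : ContinuousAt (fun s ↦ chartAt E x₀ (γ s)) t :=
    (hasDerivAt_chart_curve hγ ht).continuousAt
  have hc' : ContinuousAt (fun s ↦ deriv (fun s ↦ chartAt E x₀ (γ s)) s) t := by
    have h := ((contDiffAt_chart_curve hγ ht).fderiv_right (m := 0) (by simp)).continuousAt
    exact h.clm_apply (continuousAt_const (y := (1 : ℝ)))
  have hG : ContinuousAt (fun s ↦ Gam g x₀ (chartAt E x₀ (γ s))) t :=
    ((contDiffOn_Gam g x₀).continuousOn.continuousAt hz).comp
      (f := fun s ↦ chartAt E x₀ (γ s)) hc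
  have hdG : ContinuousAt (fun s ↦ fderiv ℝ (Gam g x₀) (chartAt E x₀ (γ s))) t :=
    (((contDiffOn_Gam g x₀).continuousOn_fderiv_of_isOpen (chartAt E x₀).open_target
      (by simp)).continuousAt hz).comp (f := fun s ↦ chartAt E x₀ (γ s)) hc
  have hB := hG.clm_apply hc'
  have hR : ContinuousAt (fun s ↦ jacOp g x₀ (chartAt E x₀ (γ s))
      (deriv (fun s ↦ chartAt E x₀ (γ s)) s)) t := by
    rw [continuousAt_clm_apply]
    intro w
    simp only [jacOp_apply, Rm]
    exact (((((hdG.clm_apply continuousAt_const).clm_apply hc').clm_apply hc').sub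
      (((hdG.clm_apply hc').clm_apply continuousAt_const).clm_apply hc')).add
      ((hG.clm_apply continuousAt_const).clm_apply (hB.clm_apply hc'))).sub
      (hB.clm_apply ((hG.clm_apply continuousAt_const).clm_apply hc'))
  rw [continuousAt_clm_apply]
  intro p
  simp only [jacCoeff_apply]
  exact (continuousAt_const.sub (hB.clm_apply continuousAt_const)).prodMk
    ((hR.clm_apply continuousAt_const).neg.sub (hB.clm_apply continuousAt_const))

/-- The Jacobi equation is a linear equation with continuous coefficients in each chart, and so a
local evolution problem. Through `IsLocalEvolution.exists_global` its solutions extend along the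
whole geodesic even though no single chart contains it. -/
lemma isLocalEvolution_jacobi (g : RiemMetric E M) {γ : ℝ → M}
    (hγ : ContMDiff 𝓘(ℝ, ℝ) 𝓘(ℝ, E) ∞ γ) : IsLocalEvolution (IsJacobiPairAt g γ) := by
  have hloc : ∀ t₀, ∃ ε > 0, ∃ x₀ : M, (∀ t ∈ Ioo (t₀ - ε) (t₀ + ε), γ t ∈ (chartAt E x₀).source) ∧
      (∀ t₁ ∈ Ioo (t₀ - ε) (t₀ + ε), ∀ x, ∃ f : ℝ → E × E, f t₁ = x ∧
        ∀ t ∈ Ioo (t₀ - ε) (t₀ + ε), HasDerivAt f (jacCoeff g x₀ γ t (f t)) t) ∧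
      ∀ a b, Ioo a b ⊆ Ioo (t₀ - ε) (t₀ + ε) → ∀ t₁ ∈ Ioo a b, ∀ f f' : ℝ → E × E,
        (∀ t ∈ Ioo a b, HasDerivAt f (jacCoeff g x₀ γ t (f t)) t) →
        (∀ t ∈ Ioo a b, HasDerivAt f' (jacCoeff g x₀ γ t (f' t)) t) →
        f t₁ = f' t₁ → EqOn f f' (Ioo a b) := by
    intro t₀
    have hs := eventually_curve_mem hγ (mem_chart_source E (γ t₀))
    obtain ⟨δ, hδ, hsδ⟩ := Metric.eventually_nhds_iff.1 hs
    obtain ⟨ε, hε, h⟩ := linearODE_local (A := jacCoeff g (γ t₀) γ) (t₀ := t₀)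
      (hs.mono fun t ht ↦ continuousAt_jacCoeff g hγ ht)
    refine ⟨min δ ε, lt_min hδ hε, γ t₀, fun t ht ↦ hsδ ?_, h _ (lt_min hδ hε) (min_le_right _ _)⟩
    rw [Real.dist_eq, abs_lt]
    exact ⟨by linarith [ht.1, min_le_left δ ε], by linarith [ht.2, min_le_left δ ε]⟩
  refine ⟨fun t f f' e h ↦ ?_, fun t₀ ↦ ?_, fun t₀ ↦ ?_⟩
  · have htt := mem_chart_source E (γ t)
    rw [isJacobiPairAt_iff g hγ htt] at h ⊢
    have e' : pairRep (γ t) γ f' =ᶠ[𝓝 t] pairRep (γ t) γ f := by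
      filter_upwards [e] with s hs
      simp only [pairRep, crep, fstField, sndField, hs]
    rw [e'.eq_of_nhds]
    exact h.congr_of_eventuallyEq e'
  · obtain ⟨ε, hε, x₀, hx₀, hex, -⟩ := hloc t₀
    refine ⟨ε, hε, fun t₁ ht₁ x ↦ ?_⟩
    obtain ⟨f, hf, hf'⟩ := hex t₁ ht₁ (coord x₀ (γ t₁) x.1, coord x₀ (γ t₁) x.2)
    refine ⟨fun t ↦ (coordSymm x₀ (γ t) (f t).1, coordSymm x₀ (γ t) (f t).2), ?_, fun t ht ↦ ?_⟩
    · exact Prod.ext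
        ((congrArg (fun q : E × E ↦ coordSymm x₀ (γ t₁) q.1) hf).trans
          (coordSymm_coord (hx₀ t₁ ht₁) x.1))
        ((congrArg (fun q : E × E ↦ coordSymm x₀ (γ t₁) q.2) hf).trans
          (coordSymm_coord (hx₀ t₁ ht₁) x.2))
    · rw [isJacobiPairAt_iff g hγ (hx₀ t ht)]
      have e : pairRep x₀ γ (fun t ↦ (coordSymm x₀ (γ t) (f t).1, coordSymm x₀ (γ t) (f t).2))
          =ᶠ[𝓝 t] f := by
        filter_upwards [Ioo_mem_nhds ht.1 ht.2] with s hs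
        exact Prod.ext (coord_coordSymm (hx₀ s hs) _) (coord_coordSymm (hx₀ s hs) _)
      rw [e.eq_of_nhds]
      exact (hf' t ht).congr_of_eventuallyEq e
  · obtain ⟨ε, hε, x₀, hx₀, -, hu⟩ := hloc t₀
    refine ⟨ε, hε, fun a b hab t₁ ht₁ f f' hf hf' h t ht ↦ ?_⟩
    have := hu a b hab t₁ ht₁ (pairRep x₀ γ f) (pairRep x₀ γ f')
      (fun t ht ↦ (isJacobiPairAt_iff g hγ (hx₀ t (hab ht)) f).1 (hf t ht))
      (fun t ht ↦ (isJacobiPairAt_iff g hγ (hx₀ t (hab ht)) f').1 (hf' t ht))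
      (by simp only [pairRep, crep, fstField, sndField, h]) ht
    exact Prod.ext (coord_injective (hx₀ t (hab ht)) (congrArg Prod.fst this))
      (coord_injective (hx₀ t (hab ht)) (congrArg Prod.snd this))

end JacobiEvolution

/-! ### Jacobi fields -/

section JacobiFields

variable {E : Type*} [NormedAddCommGroup E] [NormedSpace ℝ E]
  {M : Type*} [TopologicalSpace M] [ChartedSpace E M] [IsManifold 𝓘(ℝ, E) ∞ M]
  [FiniteDimensional ℝ E]

lemma curvature_add_left (g : RiemMetric E M) (y : M) (u u' v : TangentSpace 𝓘(ℝ, E) y) :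
    curvature g y (u + u') v v = curvature g y u v v + curvature g y u' v v := by
  have hy := mem_chart_source E y
  apply coord_injective hy
  simp only [map_add, coord_curvature g hy, ← jacOp_apply]

lemma curvature_smul_left (g : RiemMetric E M) (y : M) (c : ℝ) (u v : TangentSpace 𝓘(ℝ, E) y) :
    curvature g y (c • u) v v = c • curvature g y u v v := by
  have hy := mem_chart_source E y
  apply coord_injective hy
  simp only [map_smul, coord_curvature g hy, ← jacOp_apply]

set_option synthInstance.maxHeartbeats 200000 in
lemma Rm_smul_smul (g : RiemMetric E M) (x₀ : M) (z u v : E) (c : ℝ) :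
    Rm g x₀ z u (c • v) (c • v) = (c * c) • Rm g x₀ z u v v := by
  simp only [Rm, map_smul, smul_apply, smul_smul]
  module

lemma curvature_smul_smul (g : RiemMetric E M) (y : M) (c : ℝ) (u v : TangentSpace 𝓘(ℝ, E) y) :
    curvature g y u (c • v) (c • v) = (c * c) • curvature g y u v v := by
  have hy := mem_chart_source E y
  apply coord_injective hy
  simp only [map_smul, coord_curvature g hy, Rm_smul_smul]

lemma curvature_self (g : RiemMetric E M) (y : M) (v w : TangentSpace 𝓘(ℝ, E) y) :
    curvature g y v v w = 0 := by
  have hy := mem_chart_source E y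
  apply coord_injective hy
  rw [map_zero, coord_curvature g hy]
  simp [Rm]

/-- The operator `u ↦ R(u, v)v` is self-adjoint. -/
lemma inner_curvature (g : RiemMetric E M) (y : M) (a b v : TangentSpace 𝓘(ℝ, E) y) :
    g.inner y (curvature g y a v v) b = g.inner y a (curvature g y b v v) := by
  have hy := mem_chart_source E y
  rw [inner_eq_gm g hy, inner_eq_gm g hy, coord_curvature g hy, coord_curvature g hy,
    gm_Rm_selfAdjoint g ((chartAt E y).map_source hy)]

variable {g : RiemMetric E M} {γ : ℝ → M}

lemma isJacobiField_of_pair {p : ℝ → E × E} (hp : ∀ t, IsJacobiPairAt g γ t p) :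
    IsJacobiField g γ (fstField γ p) ∧ covDerivAlong g γ (fstField γ p) = sndField γ p := by
  have h : covDerivAlong g γ (fstField γ p) = sndField γ p := funext fun t ↦ (hp t).2.2.1
  refine ⟨⟨fun t ↦ (hp t).1, ?_, fun t ↦ ?_⟩, h⟩
  · rw [h]
    exact fun t ↦ (hp t).2.1
  · rw [h, (hp t).2.2.2, neg_add_cancel]

lemma IsJacobiField.diffAlong {Y : ∀ t, TangentSpace 𝓘(ℝ, E) (γ t)} (hY : IsJacobiField g γ Y)
    (t : ℝ) : DiffAlong γ Y t := hY.mdifferentiable t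

lemma IsJacobiField.diffAlong_deriv {Y : ∀ t, TangentSpace 𝓘(ℝ, E) (γ t)}
    (hY : IsJacobiField g γ Y) (t : ℝ) : DiffAlong γ (covDerivAlong g γ Y) t :=
  hY.mdifferentiable_deriv t

lemma IsJacobiField.pair {Y : ∀ t, TangentSpace 𝓘(ℝ, E) (γ t)} (hY : IsJacobiField g γ Y)
    (t : ℝ) : IsJacobiPairAt g γ t (fun t ↦ (Y t, covDerivAlong g γ Y t)) :=
  ⟨hY.mdifferentiable t, hY.mdifferentiable_deriv t, rfl,
    eq_neg_of_add_eq_zero_left (hY.jacobi_eq t)⟩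

/-- Jacobi fields exist for arbitrary initial data. -/
lemma exists_isJacobiField (g : RiemMetric E M) (hγ : ContMDiff 𝓘(ℝ, ℝ) 𝓘(ℝ, E) ∞ γ) (t₀ : ℝ)
    (a b : TangentSpace 𝓘(ℝ, E) (γ t₀)) :
    ∃ Y, IsJacobiField g γ Y ∧ Y t₀ = a ∧ covDerivAlong g γ Y t₀ = b := by
  obtain ⟨p, hp, hp'⟩ := (isLocalEvolution_jacobi g hγ).exists_global t₀ (a, b)
  obtain ⟨h1, h2⟩ := isJacobiField_of_pair hp'
  refine ⟨_, h1, congrArg Prod.fst hp, ?_⟩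
  rw [h2]
  exact congrArg Prod.snd hp

/-- Jacobi fields are determined by their initial data. -/
lemma IsJacobiField.eq_of_initial (hγ : ContMDiff 𝓘(ℝ, ℝ) 𝓘(ℝ, E) ∞ γ) {t₀ : ℝ}
    {Y Z : ∀ t, TangentSpace 𝓘(ℝ, E) (γ t)} (hY : IsJacobiField g γ Y) (hZ : IsJacobiField g γ Z)
    (h0 : Y t₀ = Z t₀) (h1 : covDerivAlong g γ Y t₀ = covDerivAlong g γ Z t₀) : Y = Z := by
  have h := (isLocalEvolution_jacobi g hγ).unique (t₁ := t₀) hY.pair hZ.pair (Prod.ext h0 h1)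
  exact funext fun t ↦ congrArg Prod.fst (congrFun h t)

lemma IsJacobiField.add (hγ : ContMDiff 𝓘(ℝ, ℝ) 𝓘(ℝ, E) ∞ γ)
    {Y Z : ∀ t, TangentSpace 𝓘(ℝ, E) (γ t)} (hY : IsJacobiField g γ Y) (hZ : IsJacobiField g γ Z) :
    IsJacobiField g γ (fun t ↦ Y t + Z t) := by
  have h : covDerivAlong g γ (fun t ↦ Y t + Z t) =
      fun t ↦ covDerivAlong g γ Y t + covDerivAlong g γ Z t :=
    funext fun t ↦ covDerivAlong_add g hγ (hY.diffAlong t) (hZ.diffAlong t)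
  refine ⟨fun t ↦ DiffAlong.add hγ (hY.diffAlong t) (hZ.diffAlong t), ?_, fun t ↦ ?_⟩
  · rw [h]
    exact fun t ↦ DiffAlong.add hγ (hY.diffAlong_deriv t) (hZ.diffAlong_deriv t)
  · rw [h, covDerivAlong_add g hγ (hY.diffAlong_deriv t) (hZ.diffAlong_deriv t),
      curvature_add_left, add_add_add_comm, hY.jacobi_eq, hZ.jacobi_eq, add_zero]

lemma IsJacobiField.const_smul (hγ : ContMDiff 𝓘(ℝ, ℝ) 𝓘(ℝ, E) ∞ γ) (c : ℝ)
    {Y : ∀ t, TangentSpace 𝓘(ℝ, E) (γ t)} (hY : IsJacobiField g γ Y) :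
    IsJacobiField g γ (fun t ↦ c • Y t) := by
  have h : covDerivAlong g γ (fun t ↦ c • Y t) = fun t ↦ c • covDerivAlong g γ Y t :=
    funext fun t ↦ covDerivAlong_const_smul g γ c Y t
  refine ⟨fun t ↦ DiffAlong.const_smul hγ c (hY.diffAlong t), ?_, fun t ↦ ?_⟩
  · rw [h]
    exact fun t ↦ DiffAlong.const_smul hγ c (hY.diffAlong_deriv t)
  · rw [h, covDerivAlong_const_smul, curvature_smul_left, ← smul_add, hY.jacobi_eq, smul_zero]

lemma isJacobiField_zero (hγ : ContMDiff 𝓘(ℝ, ℝ) 𝓘(ℝ, E) ∞ γ) :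
    IsJacobiField g γ (fun _ ↦ 0) := by
  obtain ⟨Y, hY, -⟩ := exists_isJacobiField g hγ 0 0 0
  simpa using hY.const_smul hγ 0

lemma IsJacobiField.eq_zero (hγ : ContMDiff 𝓘(ℝ, ℝ) 𝓘(ℝ, E) ∞ γ) {t₀ : ℝ}
    {Y : ∀ t, TangentSpace 𝓘(ℝ, E) (γ t)} (hY : IsJacobiField g γ Y)
    (h0 : Y t₀ = 0) (h1 : covDerivAlong g γ Y t₀ = 0) (t : ℝ) : Y t = 0 := by
  rw [hY.eq_of_initial hγ (isJacobiField_zero hγ) h0 (h1.trans (covDerivAlong_zero g γ t₀).symm)]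

/-- The Wronskian of two Jacobi fields is constant, because `R(·, γ')γ'` is self-adjoint. -/
lemma IsJacobiField.wronskian (hγ : ContMDiff 𝓘(ℝ, ℝ) 𝓘(ℝ, E) ∞ γ)
    {Y Z : ∀ t, TangentSpace 𝓘(ℝ, E) (γ t)} (hY : IsJacobiField g γ Y) (hZ : IsJacobiField g γ Z)
    (s t : ℝ) :
    g.inner (γ s) (covDerivAlong g γ Y s) (Z s) - g.inner (γ s) (Y s) (covDerivAlong g γ Z s) =
      g.inner (γ t) (covDerivAlong g γ Y t) (Z t) - g.inner (γ t) (Y t) (covDerivAlong g γ Z t) := by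
  have h : ∀ r, HasDerivAt (fun s ↦ g.inner (γ s) (covDerivAlong g γ Y s) (Z s) -
      g.inner (γ s) (Y s) (covDerivAlong g γ Z s)) 0 r := by
    intro r
    refine ((hasDerivAt_inner g hγ (hY.diffAlong_deriv r) (hZ.diffAlong r)).sub
      (hasDerivAt_inner g hγ (hY.diffAlong r) (hZ.diffAlong_deriv r))).congr_deriv ?_
    rw [eq_neg_of_add_eq_zero_left (hY.jacobi_eq r), eq_neg_of_add_eq_zero_left (hZ.jacobi_eq r),
      map_neg, map_neg, neg_apply, inner_curvature]
    ring
  exact is_const_of_deriv_eq_zero (fun r ↦ (h r).differentiableAt) (fun r ↦ (h r).deriv) s t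

lemma diffAlong_velocity (hγ : ContMDiff 𝓘(ℝ, ℝ) 𝓘(ℝ, E) ∞ γ) (t : ℝ) :
    DiffAlong (E := E) γ (velocity γ) t := by
  have htt := mem_chart_source E (γ t)
  rw [diffAlong_iff hγ htt]
  have h := ((contDiffAt_chart_curve hγ htt).fderiv_right (m := 1)
    (by exact WithTop.coe_le_coe.2 le_top)).differentiableAt (by simp)
  refine (h.clm_apply (differentiableAt_const (1 : ℝ))).congr_of_eventuallyEq ?_
  filter_upwards [eventually_curve_mem hγ htt] with s hs using coord_velocity hγ hs

/-- If `Y` is a Jacobi field along a geodesic, `g(Y', γ')` is constant. -/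
lemma IsJacobiField.inner_deriv_velocity (hγ : IsGeodesic g γ)
    {Y : ∀ t, TangentSpace 𝓘(ℝ, E) (γ t)} (hY : IsJacobiField g γ Y) (s t : ℝ) :
    g.inner (γ s) (velocity γ s) (covDerivAlong g γ Y s) =
      g.inner (γ t) (velocity γ t) (covDerivAlong g γ Y t) := by
  have h : ∀ r, HasDerivAt (fun s ↦ g.inner (γ s) (velocity γ s) (covDerivAlong g γ Y s)) 0 r := by
    intro r
    refine (hasDerivAt_inner g hγ.contMDiff (diffAlong_velocity hγ.contMDiff r)
      (hY.diffAlong_deriv r)).congr_deriv ?_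
    rw [hγ.geodesic_eq, eq_neg_of_add_eq_zero_left (hY.jacobi_eq r), map_neg, ← inner_curvature,
      curvature_self]
    simp
  exact is_const_of_deriv_eq_zero (fun r ↦ (h r).differentiableAt) (fun r ↦ (h r).deriv) s t

/-- If `Y` is a Jacobi field along a geodesic, `g(Y, γ')` is an affine function. -/
lemma IsJacobiField.inner_velocity (hγ : IsGeodesic g γ)
    {Y : ∀ t, TangentSpace 𝓘(ℝ, E) (γ t)} (hY : IsJacobiField g γ Y) (t : ℝ) :
    g.inner (γ t) (velocity γ t) (Y t) = g.inner (γ 0) (velocity γ 0) (Y 0) +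
      t * g.inner (γ 0) (velocity γ 0) (covDerivAlong g γ Y 0) := by
  have h : ∀ r, HasDerivAt (fun s ↦ g.inner (γ s) (velocity γ s) (Y s) -
      s * g.inner (γ 0) (velocity γ 0) (covDerivAlong g γ Y 0)) 0 r := by
    intro r
    refine ((hasDerivAt_inner g hγ.contMDiff (diffAlong_velocity hγ.contMDiff r)
      (hY.diffAlong r)).sub ((hasDerivAt_id r).mul_const _)).congr_deriv ?_
    rw [hγ.geodesic_eq, hY.inner_deriv_velocity hγ r 0]
    simp
  have := is_const_of_deriv_eq_zero (fun r ↦ (h r).differentiableAt) (fun r ↦ (h r).deriv) t 0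
  simp only [zero_mul, sub_zero] at this
  linarith

lemma IsGeodesic.comp_affine (hγ : IsGeodesic g γ) (a b : ℝ) :
    IsGeodesic g (fun s ↦ γ (a * s + b)) := by
  refine ⟨contMDiff_comp_affine hγ.contMDiff a b, fun t ↦ ?_⟩
  have h : velocity (E := E) (fun s ↦ γ (a * s + b)) = fun s ↦ a • velocity γ (a * s + b) :=
    funext fun s ↦ velocity_comp_affine hγ.contMDiff a b s
  rw [h, covDerivAlong_const_smul, covDerivAlong_comp g (velocity γ) a b t
    (velocity_comp_affine hγ.contMDiff a b t), hγ.geodesic_eq, smul_zero, smul_zero]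

lemma IsUnitSpeedGeodesic.comp_affine (hγ : IsUnitSpeedGeodesic g γ) {a : ℝ} (ha : a * a = 1)
    (b : ℝ) : IsUnitSpeedGeodesic g (fun s ↦ γ (a * s + b)) := by
  refine ⟨hγ.toIsGeodesic.comp_affine a b, fun t ↦ ?_⟩
  rw [velocity_comp_affine hγ.contMDiff, map_smul, map_smul, smul_apply, hγ.unit_speed, smul_smul,
    ha, one_smul]

lemma covDerivAlong_comp_affine (hγ : ContMDiff 𝓘(ℝ, ℝ) 𝓘(ℝ, E) ∞ γ)
    (V : ∀ t, TangentSpace 𝓘(ℝ, E) (γ t)) (a b t : ℝ) :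
    covDerivAlong g (fun s ↦ γ (a * s + b)) (fun s ↦ V (a * s + b)) t =
      a • covDerivAlong g γ V (a * t + b) :=
  covDerivAlong_comp g V a b t (velocity_comp_affine hγ a b t)

lemma IsJacobiField.comp_affine (hγ : ContMDiff 𝓘(ℝ, ℝ) 𝓘(ℝ, E) ∞ γ)
    {Y : ∀ t, TangentSpace 𝓘(ℝ, E) (γ t)} (hY : IsJacobiField g γ Y) (a b : ℝ) :
    IsJacobiField g (fun s ↦ γ (a * s + b)) (fun s ↦ Y (a * s + b)) := by
  have h : covDerivAlong g (fun s ↦ γ (a * s + b)) (fun s ↦ Y (a * s + b)) =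
      fun s ↦ a • covDerivAlong g γ Y (a * s + b) :=
    funext fun s ↦ covDerivAlong_comp_affine hγ Y a b s
  have hγ' := contMDiff_comp_affine hγ a b
  refine ⟨fun t ↦ (hY.diffAlong _).comp_affine a b, ?_, fun t ↦ ?_⟩
  · rw [h]
    exact fun t ↦ DiffAlong.const_smul hγ' a
      (DiffAlong.comp_affine (V := covDerivAlong g γ Y) a b (hY.diffAlong_deriv _))
  · rw [h, covDerivAlong_const_smul, covDerivAlong_comp_affine hγ, velocity_comp_affine hγ,
      curvature_smul_smul, smul_smul, ← smul_add, hY.jacobi_eq, smul_zero]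

end JacobiFields

/-! ### Manifolds without focal points -/

section Focal

variable {E : Type*} [NormedAddCommGroup E] [NormedSpace ℝ E]
  {M : Type*} [TopologicalSpace M] [ChartedSpace E M] [IsManifold 𝓘(ℝ, E) ∞ M]
  [FiniteDimensional ℝ E] {g : RiemMetric E M} {γ : ℝ → M}

lemma IsJacobiField.hasDerivAt_normSq (hγ : ContMDiff 𝓘(ℝ, ℝ) 𝓘(ℝ, E) ∞ γ)
    {Y : ∀ t, TangentSpace 𝓘(ℝ, E) (γ t)} (hY : IsJacobiField g γ Y) (t : ℝ) :
    HasDerivAt (fun s ↦ g.inner (γ s) (Y s) (Y s))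
      (2 * g.inner (γ t) (covDerivAlong g γ Y t) (Y t)) t := by
  refine (hasDerivAt_inner g hγ (hY.diffAlong t) (hY.diffAlong t)).congr_deriv ?_
  rw [g.symm (γ t) (Y t)]
  ring

/-- Without focal points, a Jacobi field does not get shorter after it vanishes. -/
lemma NoFocalPoints.inner_nonneg (hf : NoFocalPoints g) (hγ : IsUnitSpeedGeodesic g γ)
    {Y : ∀ t, TangentSpace 𝓘(ℝ, E) (γ t)} (hY : IsJacobiField g γ Y) (h0 : Y 0 = 0) {t : ℝ}
    (ht : 0 < t) : 0 ≤ g.inner (γ t) (covDerivAlong g γ Y t) (Y t) := by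
  by_cases h1 : covDerivAlong g γ Y 0 = 0
  · rw [hY.eq_zero hγ.contMDiff h0 h1 t, map_zero]
  · have := hf γ hγ Y hY h0 h1 t ht
    rw [(hY.hasDerivAt_normSq hγ.contMDiff t).deriv] at this
    linarith

/-- Without focal points, a Jacobi field does not get longer before it vanishes: this is
`NoFocalPoints.inner_nonneg` for the reversed geodesic. -/
lemma NoFocalPoints.inner_nonpos (hf : NoFocalPoints g) (hγ : IsUnitSpeedGeodesic g γ)
    {Y : ∀ t, TangentSpace 𝓘(ℝ, E) (γ t)} (hY : IsJacobiField g γ Y) {T t : ℝ} (hT : Y T = 0)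
    (ht : t < T) : g.inner (γ t) (covDerivAlong g γ Y t) (Y t) ≤ 0 := by
  have h := hf.inner_nonneg (hγ.comp_affine (a := -1) (by norm_num) T)
    (hY.comp_affine hγ.contMDiff (-1) T) (by
      rw [mul_zero, zero_add]
      exact hT) (t := T - t) (by linarith)
  rw [covDerivAlong_comp_affine hγ.contMDiff] at h
  have e : -1 * (T - t) + T = t := by ring
  rw [e] at h
  simp only [map_smul, smul_apply, smul_eq_mul] at h
  linarith

end Focal

/-! ### The operators `U_T` -/

section Riccati

variable {E : Type*} [NormedAddCommGroup E] [NormedSpace ℝ E]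
  {M : Type*} [TopologicalSpace M] [ChartedSpace E M] [IsManifold 𝓘(ℝ, E) ∞ M]
  [FiniteDimensional ℝ E] {g : RiemMetric E M} {γ : ℝ → M}

/-- The Jacobi field with given initial data at time `0`, as a linear map into the fields along `γ`.
Its domain is finite-dimensional, so values and derivatives depend continuously on the initial data.
-/
def jacobiSol (g : RiemMetric E M) (hγ : ContMDiff 𝓘(ℝ, ℝ) 𝓘(ℝ, E) ∞ γ) :
    (TangentSpace 𝓘(ℝ, E) (γ 0) × TangentSpace 𝓘(ℝ, E) (γ 0)) →ₗ[ℝ]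
      (∀ t, TangentSpace 𝓘(ℝ, E) (γ t)) where
  toFun p := (exists_isJacobiField g hγ 0 p.1 p.2).choose
  map_add' p q := by
    have hp := (exists_isJacobiField g hγ 0 p.1 p.2).choose_spec
    have hq := (exists_isJacobiField g hγ 0 q.1 q.2).choose_spec
    have hpq := (exists_isJacobiField g hγ 0 (p + q).1 (p + q).2).choose_spec
    exact hpq.1.eq_of_initial (t₀ := 0) hγ (hp.1.add hγ hq.1)
      (hpq.2.1.trans (congrArg₂ (· + ·) hp.2.1 hq.2.1).symm)
      (hpq.2.2.trans ((covDerivAlong_add g hγ (hp.1.diffAlong 0) (hq.1.diffAlong 0)).trans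
        (congrArg₂ (· + ·) hp.2.2 hq.2.2)).symm)
  map_smul' c p := by
    have hp := (exists_isJacobiField g hγ 0 p.1 p.2).choose_spec
    have hcp := (exists_isJacobiField g hγ 0 (c • p).1 (c • p).2).choose_spec
    exact hcp.1.eq_of_initial (t₀ := 0) hγ (hp.1.const_smul hγ c)
      (hcp.2.1.trans (congrArg (c • ·) hp.2.1).symm)
      (hcp.2.2.trans ((covDerivAlong_const_smul g γ c _ 0).trans (congrArg (c • ·) hp.2.2)).symm)

lemma jacobiSol_spec (g : RiemMetric E M) (hγ : ContMDiff 𝓘(ℝ, ℝ) 𝓘(ℝ, E) ∞ γ)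
    (p : TangentSpace 𝓘(ℝ, E) (γ 0) × TangentSpace 𝓘(ℝ, E) (γ 0)) :
    IsJacobiField g γ (jacobiSol g hγ p) ∧ jacobiSol g hγ p 0 = p.1 ∧
      covDerivAlong g γ (jacobiSol g hγ p) 0 = p.2 :=
  (exists_isJacobiField g hγ 0 p.1 p.2).choose_spec

lemma IsJacobiField.eq_jacobiSol (hγ : ContMDiff 𝓘(ℝ, ℝ) 𝓘(ℝ, E) ∞ γ)
    {Y : ∀ t, TangentSpace 𝓘(ℝ, E) (γ t)} (hY : IsJacobiField g γ Y) :
    Y = jacobiSol g hγ (Y 0, covDerivAlong g γ Y 0) := by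
  have h := jacobiSol_spec g hγ (Y 0, covDerivAlong g γ Y 0)
  exact hY.eq_of_initial (t₀ := 0) hγ h.1 h.2.1.symm h.2.2.symm

/-- The value at time `t` of the Jacobi field with given initial data. -/
def jacobiVal (g : RiemMetric E M) (hγ : ContMDiff 𝓘(ℝ, ℝ) 𝓘(ℝ, E) ∞ γ) (t : ℝ) :
    (TangentSpace 𝓘(ℝ, E) (γ 0) × TangentSpace 𝓘(ℝ, E) (γ 0)) →ₗ[ℝ] TangentSpace 𝓘(ℝ, E) (γ t) :=
  LinearMap.proj t ∘ₗ jacobiSol g hγ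

/-- The derivative at time `t` of the Jacobi field with given initial data. -/
def jacobiDeriv (g : RiemMetric E M) (hγ : ContMDiff 𝓘(ℝ, ℝ) 𝓘(ℝ, E) ∞ γ) (t : ℝ) :
    (TangentSpace 𝓘(ℝ, E) (γ 0) × TangentSpace 𝓘(ℝ, E) (γ 0)) →ₗ[ℝ] TangentSpace 𝓘(ℝ, E) (γ t) where
  toFun p := covDerivAlong g γ (jacobiSol g hγ p) t
  map_add' p q := by
    rw [map_add]
    exact covDerivAlong_add g hγ ((jacobiSol_spec g hγ p).1.diffAlong t)
      ((jacobiSol_spec g hγ q).1.diffAlong t)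
  map_smul' c p := by
    rw [map_smul]
    exact covDerivAlong_const_smul g γ c _ t

/-- The operators `U_T` exist on manifolds without conjugate points. -/
lemma exists_isRiccatiAt (hc : NoConjugatePoints g) (hγ : IsUnitSpeedGeodesic g γ) {T : ℝ}
    (hT : 0 < T) : ∃ U, IsRiccatiAt g γ T U := by
  -- `A` and `B` give the value at `T` of the Jacobi fields with `Y(0) = 0` and with `Y'(0) = 0`;
  -- absence of conjugate points means that `A` is invertible, and `U_T = -A⁻¹ B`
  let A : TangentSpace 𝓘(ℝ, E) (γ 0) →ₗ[ℝ] TangentSpace 𝓘(ℝ, E) (γ T) :=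
    jacobiVal g hγ.contMDiff T ∘ₗ LinearMap.inr ℝ _ _
  let B : TangentSpace 𝓘(ℝ, E) (γ 0) →ₗ[ℝ] TangentSpace 𝓘(ℝ, E) (γ T) :=
    jacobiVal g hγ.contMDiff T ∘ₗ LinearMap.inl ℝ _ _
  have hA : Function.Injective A := by
    rw [injective_iff_map_eq_zero]
    intro b hb
    obtain ⟨h1, h2, h3⟩ := jacobiSol_spec g hγ.contMDiff (0, b)
    have h := hc γ hγ _ h1 h2 T hT.ne' hb
    have : jacobiSol g hγ.contMDiff (0, b) = fun _ ↦ 0 := funext h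
    rw [this, covDerivAlong_zero] at h3
    exact h3.symm
  let e : TangentSpace 𝓘(ℝ, E) (γ 0) ≃ₗ[ℝ] TangentSpace 𝓘(ℝ, E) (γ T) :=
    LinearEquiv.ofBijective A ⟨hA, (LinearMap.injective_iff_surjective (K := ℝ) (V := E)).1 hA⟩
  let U₀ : TangentSpace 𝓘(ℝ, E) (γ 0) →ₗ[ℝ] TangentSpace 𝓘(ℝ, E) (γ 0) :=
    -(e.symm.toLinearMap ∘ₗ B)
  have hU₀ : ∀ w, jacobiSol g hγ.contMDiff (w, U₀ w) T = 0 := by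
    intro w
    have h1 : jacobiVal g hγ.contMDiff T (w, U₀ w) = B w + A (U₀ w) := by
      rw [show (w, U₀ w) = LinearMap.inl ℝ _ _ w + LinearMap.inr ℝ _ _ (U₀ w) by simp, map_add]
      rfl
    refine h1.trans ?_
    have h2 : A (U₀ w) = - B w := by
      have : A (e.symm (B w)) = B w := e.apply_symm_apply (B w)
      change A (-(e.symm (B w))) = -B w
      rw [map_neg, this]
    rw [h2, add_neg_cancel]
  have hU₁ : ∀ w : normalSpace g γ, U₀ w ∈ normalSpace g γ := by
    intro w
    obtain ⟨h1, h2, h3⟩ := jacobiSol_spec g hγ.contMDiff (w, U₀ w)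
    have h := h1.inner_velocity hγ.toIsGeodesic T
    have hw : g.inner (γ 0) (velocity γ 0) w = 0 := w.2
    rw [hU₀, h2, h3, hw, map_zero] at h
    rw [zero_add] at h
    exact (mul_eq_zero.1 h.symm).resolve_left hT.ne'
  refine ⟨(U₀ ∘ₗ (normalSpace g γ).subtype).codRestrict _ hU₁, fun w ↦ ?_⟩
  obtain ⟨h1, h2, h3⟩ := jacobiSol_spec g hγ.contMDiff (w, U₀ w)
  exact ⟨_, h1, h2, hU₀ w, h3⟩

/-- `U_T` is symmetric: the Wronskian of the Jacobi fields that define `U_T w` and `U_T z` vanishes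
at `T`. -/
lemma IsRiccatiAt.symmetric (hγ : ContMDiff 𝓘(ℝ, ℝ) 𝓘(ℝ, E) ∞ γ) {T : ℝ}
    {U : normalSpace g γ →ₗ[ℝ] normalSpace g γ} (hU : IsRiccatiAt g γ T U)
    (w z : normalSpace g γ) : g.inner (γ 0) (U w) z = g.inner (γ 0) w (U z) := by
  obtain ⟨Y, hY, hY0, hYT, hY'⟩ := hU w
  obtain ⟨Z, hZ, hZ0, hZT, hZ'⟩ := hU z
  have h := hY.wronskian hγ hZ 0 T
  rw [hY0, hY', hZ0, hZ', hYT, hZT, map_zero, map_zero, zero_apply] at h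
  linarith

/-- Without focal points `U_T` is negative semidefinite: `2 g(U_T w, w)` is the derivative at `0` of
the squared length of a Jacobi field that vanishes at `T`. -/
lemma IsRiccatiAt.nonpos (hf : NoFocalPoints g) (hγ : IsUnitSpeedGeodesic g γ) {T : ℝ}
    (hT : 0 < T) {U : normalSpace g γ →ₗ[ℝ] normalSpace g γ} (hU : IsRiccatiAt g γ T U)
    (w : normalSpace g γ) : g.inner (γ 0) (U w) w ≤ 0 := by
  obtain ⟨Y, hY, hY0, hYT, hY'⟩ := hU w
  have h := hf.inner_nonpos hγ hY hYT hT
  rwa [hY0, hY'] at h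

/-- The operators `U_T` increase with `T`: for the Jacobi fields `Y_S`, `Y_T` that define them, the
Wronskian of `Y_T - Y_S` and `Y_T` is `g(U_T w - U_S w, w)` at time `0`, and it is nonnegative at
time `S` because `Y_T - Y_S` vanishes at `0` and `Y_T` vanishes at `T`. -/
lemma IsRiccatiAt.mono (hf : NoFocalPoints g) (hγ : IsUnitSpeedGeodesic g γ) {S T : ℝ}
    (hS : 0 < S) (hST : S ≤ T) {U V : normalSpace g γ →ₗ[ℝ] normalSpace g γ}
    (hU : IsRiccatiAt g γ S U) (hV : IsRiccatiAt g γ T V) (w : normalSpace g γ) :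
    g.inner (γ 0) (U w) w ≤ g.inner (γ 0) (V w) w := by
  obtain ⟨Y, hY, hY0, hYS, hY'⟩ := hU w
  obtain ⟨Z, hZ, hZ0, hZT, hZ'⟩ := hV w
  have hW := hZ.add hγ.contMDiff (hY.const_smul hγ.contMDiff (-1))
  have hD : ∀ t, covDerivAlong g γ (fun t ↦ Z t + (-1 : ℝ) • Y t) t =
      covDerivAlong g γ Z t + (-1 : ℝ) • covDerivAlong g γ Y t := fun t ↦ by
    rw [covDerivAlong_add g hγ.contMDiff (hZ.diffAlong t)
      ((hY.const_smul hγ.contMDiff (-1)).diffAlong t), covDerivAlong_const_smul]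
  have h1 := hf.inner_nonneg hγ hW (by rw [hZ0, hY0]; simp) hS
  have h2 : g.inner (γ S) (covDerivAlong g γ Z S) (Z S) ≤ 0 := by
    rcases hST.lt_or_eq with h | rfl
    · exact hf.inner_nonpos hγ hZ hZT h
    · rw [hZT, map_zero]
  have h3 := hW.wronskian hγ.contMDiff hZ 0 S
  rw [hD, hYS, smul_zero, add_zero] at h1
  rw [hD, hD, hZ0, hY0, hY', hZ', hYS, smul_zero, add_zero] at h3
  simp only [map_add, map_smul, add_apply, smul_apply, smul_eq_mul] at h1 h3
  rw [g.symm (γ S) (Z S)] at h3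
  linarith

end Riccati

/-! ### Symmetric operators and convergence in finite dimension -/

section Abstract

/-- A negative semidefinite operator, symmetric for a positive definite form, vanishes if its trace
does: its eigenvalues are nonpositive and add up to `0`. -/
lemma eq_zero_of_trace_eq_zero {V : Type*} [AddCommGroup V] [Module ℝ V] [FiniteDimensional ℝ V]
    (B : V →ₗ[ℝ] V →ₗ[ℝ] ℝ) (hsymm : ∀ v w, B v w = B w v) (hpos : ∀ v, v ≠ 0 → 0 < B v v)
    (U : V →ₗ[ℝ] V) (hU : ∀ v w, B (U v) w = B v (U w)) (hneg : ∀ v, B (U v) v ≤ 0)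
    (htr : LinearMap.trace ℝ V U = 0) : U = 0 := by
  have hnonneg : ∀ v, 0 ≤ B v v := fun v ↦ by
    rcases eq_or_ne v 0 with rfl | h
    · simp
    · exact (hpos v h).le
  let core : InnerProductSpace.Core ℝ V :=
    { inner := fun v w ↦ B v w
      conj_inner_symm := fun v w ↦ by simpa using hsymm w v
      re_inner_nonneg := fun v ↦ by simpa using hnonneg v
      add_left := fun u v w ↦ by simp
      smul_left := fun v w c ↦ by simp
      definite := fun v hv ↦ by_contra fun h ↦ (hpos v h).ne' hv }
  let _ : NormedAddCommGroup V := core.toNormedAddCommGroup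
  let _ : InnerProductSpace ℝ V := InnerProductSpace.ofCore core.toCore
  have hS : U.IsSymmetric := hU
  have hev : ∀ i, hS.eigenvalues rfl i ≤ 0 := fun i ↦ by
    have h := hneg (hS.eigenvectorBasis rfl i)
    rw [hS.apply_eigenvectorBasis rfl i] at h
    have h1 : B (hS.eigenvectorBasis rfl i) (hS.eigenvectorBasis rfl i) = 1 :=
      inner_self_eq_one_of_norm_eq_one ((hS.eigenvectorBasis rfl).orthonormal.1 i)
    simpa [h1] using h
  have hsum : ∑ i, hS.eigenvalues rfl i = 0 := by
    rw [← htr, hS.trace_eq_sum_eigenvalues rfl]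
    simp
  have hzero := (Finset.sum_eq_zero_iff_of_nonpos fun i _ ↦ hev i).1 hsum
  refine (hS.eigenvectorBasis rfl).toBasis.ext fun i ↦ ?_
  rw [OrthonormalBasis.coe_toBasis, hS.apply_eigenvectorBasis rfl i, hzero i (Finset.mem_univ i)]
  simp

/-- Weak convergence with respect to a nondegenerate form is convergence, in finite dimension. -/
lemma exists_tendsto_of_bilin {α V : Type*} [AddCommGroup V] [Module ℝ V] [FiniteDimensional ℝ V]
    [TopologicalSpace V] [IsTopologicalAddGroup V] [ContinuousSMul ℝ V] {l : Filter α}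
    (B : V →ₗ[ℝ] V →ₗ[ℝ] ℝ) (hpos : ∀ v, v ≠ 0 → 0 < B v v) (f : α → V)
    (hf : ∀ w, ∃ c, Tendsto (fun a ↦ B (f a) w) l (𝓝 c)) : ∃ v, Tendsto f l (𝓝 v) := by
  let b := Module.finBasis ℝ V
  let L : V →ₗ[ℝ] (Fin (Module.finrank ℝ V) → ℝ) := LinearMap.pi fun i ↦ B.flip (b i)
  have hL : Function.Injective L := by
    rw [injective_iff_map_eq_zero]
    intro v hv
    have h1 : B v = 0 := b.ext fun i ↦ congrFun hv i
    by_contra h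
    exact (hpos v h).ne' (by rw [h1]; rfl)
  let e := LinearEquiv.ofInjectiveOfFinrankEq L hL (by simp)
  choose c hc using hf
  have h1 : Tendsto (fun a ↦ L (f a)) l (𝓝 fun i ↦ c (b i)) :=
    tendsto_pi_nhds.2 fun i ↦ hc (b i)
  have h2 : Continuous e.symm := e.symm.toLinearMap.continuous_on_pi
  refine ⟨_, (h2.continuousAt.tendsto.comp h1).congr fun a ↦ ?_⟩
  exact e.symm_apply_apply (f a)

end Abstract

/-! ### The stable Riccati operator -/

section Stable

variable {E : Type*} [NormedAddCommGroup E] [NormedSpace ℝ E]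
  {M : Type*} [TopologicalSpace M] [ChartedSpace E M] [IsManifold 𝓘(ℝ, E) ∞ M]
  [FiniteDimensional ℝ E] {g : RiemMetric E M} {γ : ℝ → M}

instance (x : M) : FiniteDimensional ℝ (TangentSpace 𝓘(ℝ, E) x) :=
  inferInstanceAs (FiniteDimensional ℝ E)

instance (x : M) : T2Space (TangentSpace 𝓘(ℝ, E) x) :=
  inferInstanceAs (T2Space E)

/-- The restriction of the metric to `v^⊥`. -/
def normalForm (g : RiemMetric E M) (γ : ℝ → M) :
    normalSpace g γ →ₗ[ℝ] normalSpace g γ →ₗ[ℝ] ℝ :=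
  LinearMap.mk₂ ℝ (fun w z ↦ g.inner (γ 0) w z) (by simp) (by simp) (by simp) (by simp)

lemma normalForm_apply (w z : normalSpace g γ) : normalForm g γ w z = g.inner (γ 0) w z := rfl

lemma normalForm_pos (w : normalSpace g γ) (hw : w ≠ 0) : 0 < normalForm g γ w w :=
  g.pos (γ 0) w fun h ↦ hw (Subtype.ext h)

/-- The stable Riccati operator exists: the forms of the `U_T` increase with `T` and are bounded
above by `0`. -/
lemma exists_isStableRiccati (hc : NoConjugatePoints g) (hf : NoFocalPoints g)
    (hγ : IsUnitSpeedGeodesic g γ) : ∃ U, IsStableRiccati g γ U := by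
  have hex : ∀ T : ℝ, ∃ U, 0 < T → IsRiccatiAt g γ T U := fun T ↦ by
    by_cases hT : 0 < T
    · exact (exists_isRiccatiAt hc hγ hT).imp fun _ h _ ↦ h
    · exact ⟨0, fun h ↦ absurd h hT⟩
  choose UT hUT using hex
  -- the operators are defined for `T > 0` only; `max T 1` makes the forms monotone on all of `ℝ`
  have hmax : ∀ T : ℝ, 0 < max T 1 := fun T ↦ lt_max_of_lt_right one_pos
  have hquad : ∀ w : normalSpace g γ,
      ∃ c, Tendsto (fun T ↦ normalForm g γ (UT T w) w) atTop (𝓝 c) := by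
    intro w
    have hmono : Monotone fun T ↦ normalForm g γ (UT (max T 1) w) w := fun S T h ↦
      (hUT _ (hmax S)).mono hf hγ (hmax S) (max_le_max_right 1 h) (hUT _ (hmax T)) w
    have hbdd : BddAbove (range fun T ↦ normalForm g γ (UT (max T 1) w) w) :=
      ⟨0, by rintro _ ⟨T, rfl⟩; exact (hUT _ (hmax T)).nonpos hf hγ (hmax T) w⟩
    refine ⟨_, (tendsto_atTop_ciSup hmono hbdd).congr' ?_⟩
    filter_upwards [eventually_ge_atTop 1] with T hT
    rw [max_eq_left hT]
  have hbil : ∀ w z : normalSpace g γ,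
      ∃ c, Tendsto (fun T ↦ normalForm g γ (UT T w) z) atTop (𝓝 c) := by
    intro w z
    obtain ⟨c₁, h₁⟩ := hquad (w + z)
    obtain ⟨c₂, h₂⟩ := hquad w
    obtain ⟨c₃, h₃⟩ := hquad z
    refine ⟨_, (((h₁.sub h₂).sub h₃).const_mul (1 / 2)).congr' ?_⟩
    filter_upwards [eventually_gt_atTop 0] with T hT
    have h : normalForm g γ (UT T z) w = normalForm g γ (UT T w) z := by
      rw [normalForm_apply, (hUT T hT).symmetric hγ.contMDiff, g.symm]
      rfl
    simp only [map_add, LinearMap.add_apply]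
    linarith
  choose U hU using fun w ↦
    exists_tendsto_of_bilin (normalForm g γ) normalForm_pos (fun T ↦ UT T w) (hbil w)
  exact ⟨linearMapOfTendsto U UT (tendsto_pi_nhds.2 hU), UT, hUT, hU⟩

/-- Without focal points the stable Riccati operators are negative semidefinite; so they vanish
where their trace does. -/
lemma isStableRiccati_zero (hc : NoConjugatePoints g) (hf : NoFocalPoints g)
    (hγ : IsUnitSpeedGeodesic g γ) (htr : traceStable g γ = 0) : IsStableRiccati g γ 0 := by
  have hex := exists_isStableRiccati hc hf hγ
  have hst : IsStableRiccati g γ (stableRiccati g γ) := by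
    rw [stableRiccati, dif_pos hex]
    exact hex.choose_spec
  obtain ⟨UT, hUT, hlim⟩ := id hst
  have hl : ∀ w z, Tendsto (fun T ↦ normalForm g γ (UT T w) z) atTop
      (𝓝 (normalForm g γ (stableRiccati g γ w) z)) := fun w z ↦
    (((normalForm g γ).flip z).continuous_of_finiteDimensional.tendsto _).comp (hlim w)
  have h0 : stableRiccati g γ = 0 := by
    refine eq_zero_of_trace_eq_zero (normalForm g γ) (fun v w ↦ g.symm (γ 0) v w) normalForm_pos _
      (fun w z ↦ ?_) (fun w ↦ ?_) htr
    · refine tendsto_nhds_unique (hl w z) (Tendsto.congr' ?_ ((hl z w).congr fun T ↦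
        g.symm (γ 0) (UT T z) w) |>.trans (le_of_eq (congrArg 𝓝 (g.symm (γ 0) _ _))))
      filter_upwards [eventually_gt_atTop 0] with T hT
      exact ((hUT T hT).symmetric hγ.contMDiff w z).symm
    · refine le_of_tendsto (hl w w) ?_
      filter_upwards [eventually_gt_atTop 0] with T hT
      exact (hUT T hT).nonpos hf hγ hT w
  rwa [h0] at hst

end Stable

/-! ### Rigidity -/

section Rigidity

variable {E : Type*} [NormedAddCommGroup E] [NormedSpace ℝ E]
  {M : Type*} [TopologicalSpace M] [ChartedSpace E M] [IsManifold 𝓘(ℝ, E) ∞ M]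
  [FiniteDimensional ℝ E] {g : RiemMetric E M} {γ : ℝ → M}

lemma tendsto_inner (g : RiemMetric E M) (x : M) {α : Type*} {l : Filter α}
    {a b : α → TangentSpace 𝓘(ℝ, E) x} {a₀ b₀ : TangentSpace 𝓘(ℝ, E) x}
    (ha : Tendsto a l (𝓝 a₀)) (hb : Tendsto b l (𝓝 b₀)) :
    Tendsto (fun i ↦ g.inner x (a i) (b i)) l (𝓝 (g.inner x a₀ b₀)) := by
  have h (B : E →L[ℝ] E →L[ℝ] ℝ) {a b : α → E} {a₀ b₀ : E} (ha : Tendsto a l (𝓝 a₀))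
      (hb : Tendsto b l (𝓝 b₀)) : Tendsto (fun i ↦ B (a i) (b i)) l (𝓝 (B a₀ b₀)) :=
    (B.continuous₂.tendsto (a₀, b₀)).comp (ha.prodMk_nhds hb)
  exact h (g.inner x) ha hb

/-- If the stable Riccati operators vanish, then the Jacobi fields normal to `γ` with zero initial
derivative are parallel. Such a field `Y` is the limit of the Jacobi fields `Y_T` that agree with it
at `0` and vanish at `T`. The Wronskian of `Y_T` and of the field that starts at time `t` from
`z = Y'(t)` and vanishes at `T` gives `g(Y_T'(t), z) = g(Y_T(t), U_{T-t} z)`, and the right hand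
side tends to `0`. -/
lemma covDerivAlong_jacobiSol_eq_zero
    (h0 : ∀ δ : ℝ → M, IsUnitSpeedGeodesic g δ → IsStableRiccati g δ 0)
    (hγ : IsUnitSpeedGeodesic g γ) (w : normalSpace g γ) (t : ℝ) :
    covDerivAlong g γ (jacobiSol g hγ.contMDiff (w, 0)) t = 0 := by
  obtain ⟨UT, hUT, hUlim⟩ := h0 γ hγ
  have hδ := hγ.comp_affine (a := 1) (by norm_num) t
  obtain ⟨VT, hVT, hVlim⟩ := h0 _ hδ
  obtain ⟨hY, hY0, hY'⟩ := jacobiSol_spec g hγ.contMDiff (w, 0)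
  -- the shifted geodesic starts at `γ (1 * 0 + t)`, so that the time is written in this way until the
  -- end
  have key : covDerivAlong g γ (jacobiSol g hγ.contMDiff (w, 0)) (1 * 0 + t) = 0 := by
    set z := covDerivAlong g γ (jacobiSol g hγ.contMDiff (w, 0)) (1 * 0 + t) with hz
    have hzN : z ∈ normalSpace g fun s ↦ γ (1 * s + t) := by
      rw [LinearMap.mem_ker]
      refine (congrArg (fun v ↦ g.inner (γ (1 * 0 + t)) v z)
        (velocity_comp_affine hγ.contMDiff 1 t 0)).trans ?_
      rw [one_smul, hz, hY.inner_deriv_velocity hγ.toIsGeodesic _ 0, hY', map_zero]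
    have hpair : Tendsto (fun T ↦ ((w : TangentSpace 𝓘(ℝ, E) (γ 0)),
        (UT T w : TangentSpace 𝓘(ℝ, E) (γ 0)))) atTop (𝓝 ((w : TangentSpace 𝓘(ℝ, E) (γ 0)), 0)) :=
      tendsto_const_nhds.prodMk_nhds ((continuous_subtype_val.tendsto _).comp (hUlim w))
    have hval := ((jacobiVal g hγ.contMDiff (1 * 0 + t)).continuous_of_finiteDimensional.tendsto
      _).comp hpair
    have hder := ((jacobiDeriv g hγ.contMDiff (1 * 0 + t)).continuous_of_finiteDimensional.tendsto
      _).comp hpair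
    have hV : Tendsto (fun T ↦ (VT (T - t) ⟨z, hzN⟩ : TangentSpace 𝓘(ℝ, E) (γ (1 * 0 + t))))
        atTop (𝓝 0) :=
      (continuous_subtype_val.tendsto _).comp
        ((hVlim ⟨z, hzN⟩).comp (tendsto_atTop_add_const_right _ (-t) tendsto_id))
    have hl := tendsto_inner g (γ (1 * 0 + t)) hder tendsto_const_nhds (b₀ := z)
    have hr := tendsto_inner g (γ (1 * 0 + t)) hval hV
    have heq : g.inner (γ (1 * 0 + t)) z z = 0 := by
      refine tendsto_nhds_unique hl ((hr.congr' ?_).trans (le_of_eq (congrArg 𝓝 (map_zero _))))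
      filter_upwards [eventually_gt_atTop 0, eventually_gt_atTop t] with T hT hTt
      obtain ⟨Y, hY, hY0, hYT, hY'⟩ := hUT T hT w
      obtain ⟨Z, hZ, hZ0, hZT, hZ'⟩ := hVT (T - t) (sub_pos.2 hTt) ⟨z, hzN⟩
      have hYeq := hY.eq_jacobiSol hγ.contMDiff
      rw [hY0, hY'] at hYeq
      have hW := (hY.comp_affine hγ.contMDiff 1 t).wronskian hδ.contMDiff hZ 0 (T - t)
      have e : 1 * (T - t) + t = T := by ring
      have hYS : Y (1 * (T - t) + t) = 0 := by rw [e]; exact hYT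
      rw [hZT, hZ', hZ0, hYS, covDerivAlong_comp_affine hγ.contMDiff, one_smul, map_zero,
        map_zero, zero_apply, sub_zero, hYeq] at hW
      exact (sub_eq_zero.1 hW).symm
    by_contra h
    exact (g.pos _ z h).ne' heq
  have e : 1 * 0 + t = t := by ring
  rwa [e] at key

/-- If the stable Riccati operators vanish, then `R(·, γ')γ' = 0`: for normal vectors by the Jacobi
equation of a parallel Jacobi field, and `R(γ', γ') = 0` in any case. -/
lemma curvature_velocity_eq_zero
    (h0 : ∀ δ : ℝ → M, IsUnitSpeedGeodesic g δ → IsStableRiccati g δ 0)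
    (hγ : IsUnitSpeedGeodesic g γ) (w : TangentSpace 𝓘(ℝ, E) (γ 0)) :
    curvature g (γ 0) w (velocity γ 0) (velocity γ 0) = 0 := by
  have hnormal : ∀ w : normalSpace g γ,
      curvature g (γ 0) w (velocity γ 0) (velocity γ 0) = 0 := by
    intro w
    obtain ⟨hY, hY0, -⟩ := jacobiSol_spec g hγ.contMDiff (w, 0)
    have h := hY.jacobi_eq 0
    have hpar : covDerivAlong g γ (jacobiSol g hγ.contMDiff (w, 0)) = fun _ ↦ 0 :=
      funext (covDerivAlong_jacobiSol_eq_zero h0 hγ w)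
    rwa [hpar, covDerivAlong_zero, zero_add, hY0] at h
  set c := g.inner (γ 0) (velocity γ 0) w with hc
  have hw : w + (-c) • velocity γ 0 ∈ normalSpace g γ := by
    rw [LinearMap.mem_ker]
    change g.inner (γ 0) (velocity γ 0) (w + (-c) • velocity γ 0) = 0
    rw [map_add, map_smul, hγ.unit_speed, ← hc, smul_eq_mul]
    ring
  have h := hnormal ⟨_, hw⟩
  rwa [curvature_add_left, curvature_smul_left, curvature_self, smul_zero, add_zero] at h

/-- Geodesics have constant speed. -/
lemma IsGeodesic.isUnitSpeedGeodesic (hγ : IsGeodesic g γ)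
    (h : g.inner (γ 0) (velocity γ 0) (velocity γ 0) = 1) : IsUnitSpeedGeodesic g γ := by
  refine ⟨hγ, fun t ↦ ?_⟩
  have hd : ∀ r, HasDerivAt (fun s ↦ g.inner (γ s) (velocity γ s) (velocity γ s)) 0 r := fun r ↦ by
    refine (hasDerivAt_inner g hγ.contMDiff (diffAlong_velocity hγ.contMDiff r)
      (diffAlong_velocity hγ.contMDiff r)).congr_deriv ?_
    rw [hγ.geodesic_eq r, map_zero, map_zero, zero_apply, add_zero]
  exact (is_const_of_deriv_eq_zero (fun r ↦ (hd r).differentiableAt) (fun r ↦ (hd r).deriv)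
    t 0).trans h

/-- On a complete manifold with vanishing stable Riccati operators the operators `R(·, v)v` are
zero. -/
lemma curvature_eq_zero_of_complete (hcomp : IsCompleteMetric g)
    (h0 : ∀ δ : ℝ → M, IsUnitSpeedGeodesic g δ → IsStableRiccati g δ 0)
    (x : M) (w v : TangentSpace 𝓘(ℝ, E) x) : curvature g x w v v = 0 := by
  rcases eq_or_ne v 0 with rfl | hv
  · simpa using curvature_smul_smul g x 0 w 0
  set r := g.inner x v v with hr
  have hrpos : 0 < r := g.pos x v hv
  have hs : √r * √r = r := Real.mul_self_sqrt hrpos.le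
  have hs0 : √r ≠ 0 := (Real.sqrt_pos.2 hrpos).ne'
  obtain ⟨γ, hγ, hp⟩ := hcomp ⟨x, (√r)⁻¹ • v⟩
  have hunit : g.inner (γ 0) (velocity γ 0) (velocity γ 0) = 1 := by
    have h1 : g.inner x ((√r)⁻¹ • v) ((√r)⁻¹ • v) = 1 := by
      rw [map_smul, map_smul, smul_apply, ← hr, smul_eq_mul, smul_eq_mul]
      field_simp
      rw [sq, hs]
    exact (congrArg (fun p : TangentBundle 𝓘(ℝ, E) M ↦ g.inner p.1 p.2 p.2) hp).trans h1
  have h := curvature_velocity_eq_zero h0 (hγ.isUnitSpeedGeodesic hunit)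
  have h' : ∀ w, curvature g x w ((√r)⁻¹ • v) ((√r)⁻¹ • v) = 0 :=
    (congrArg (fun p : TangentBundle 𝓘(ℝ, E) M ↦ ∀ w, curvature g p.1 w p.2 p.2 = 0) hp).mp h
  have h1 := curvature_smul_smul g x (√r) w ((√r)⁻¹ • v)
  rwa [h', smul_zero, smul_smul, mul_inv_cancel₀ hs0, one_smul] at h1

set_option synthInstance.maxHeartbeats 200000 in
lemma Rm_add_add (g : RiemMetric E M) (x₀ : M) (z u v w : E) :
    Rm g x₀ z u (v + w) (v + w) =
      Rm g x₀ z u v v + Rm g x₀ z u w w + (Rm g x₀ z u v w + Rm g x₀ z u w v) := by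
  simp only [Rm, map_add, add_apply]
  abel

/-- The curvature tensor is determined by the operators `R(·, v)v`: if they vanish, then `R` is
skew-symmetric in its last two arguments as well as in its first two, and the Bianchi identity
reads `3 R = 0`. -/
lemma isFlat_of_curvature_eq_zero (h : ∀ (x : M) (w v : TangentSpace 𝓘(ℝ, E) x),
    curvature g x w v v = 0) : IsFlat g := by
  intro x u v w
  have hx := mem_chart_source E x
  apply coord_injective hx
  rw [map_zero, coord_curvature g hx]
  set z := chartAt E x x
  have h0 : ∀ a b : E, Rm g x z a b b = 0 := fun a b ↦ by
    have h1 := coord_curvature g hx (coordSymm x x a) (coordSymm x x b) (coordSymm x x b)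
    rw [h, map_zero, coord_coordSymm_self, coord_coordSymm_self] at h1
    exact h1.symm
  have hskew : ∀ a b c : E, Rm g x z a b c = - Rm g x z a c b := fun a b c ↦ by
    have h1 := Rm_add_add g x z a b c
    rw [h0, h0, h0, add_zero, zero_add] at h1
    exact eq_neg_of_add_eq_zero_left h1.symm
  generalize coord x x u = a
  generalize coord x x v = b
  generalize coord x x w = c
  have hb := Rm_bianchi g ((chartAt E x).map_source hx) a b c
  have h1 : Rm g x z b c a = Rm g x z a b c := by
    rw [hskew b c a, Rm_antisymm g x z b a c, neg_neg]
  have h2 : Rm g x z c a b = Rm g x z a b c := by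
    rw [hskew c a b, Rm_antisymm g x z c b a, neg_neg, h1]
  have h3 : (3 : ℝ) • Rm g x z a b c = 0 := by
    rw [h1, h2] at hb
    rw [← hb]
    module
  exact (smul_eq_zero.1 h3).resolve_left (by norm_num)

end Rigidity

end Riem

end

/-- An asymptotically harmonic manifold without focal points whose stable Riccati solutions have
identically vanishing trace is flat. -/
theorem lemma3p3 {E : Type*} [NormedAddCommGroup E] [NormedSpace ℝ E] [FiniteDimensional ℝ E]
    {M : Type*} [TopologicalSpace M] [T2Space M] [ChartedSpace E M] [IsManifold 𝓘(ℝ, E) ∞ M]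
    (g : Riem.RiemMetric E M)
    (hharm : Riem.IsAsymptoticallyHarmonic g)
    (hfocal : Riem.NoFocalPoints g)
    (htrace : ∀ γ : ℝ → M, Riem.IsUnitSpeedGeodesic g γ → Riem.traceStable g γ = 0) :
    Riem.IsFlat g :=
  Riem.isFlat_of_curvature_eq_zero (Riem.curvature_eq_zero_of_complete hharm.complete fun γ hγ ↦
    Riem.isStableRiccati_zero hharm.noConjugatePoints hfocal hγ (htrace γ hγ))
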